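/- Let $n,m\ge 1$, $A\in\mathbb R^{n\times n}$, $B\in\mathbb R^{n\times m}$, let $Q\in\mathbb R^{n\times n}$ and $R\in\mathbb R^{m\times m}$ be symmetric positive definite, let $x_0^1,\dots,x_0^n$ span $\mathbb R^n$, and put $\Sigma=\sum_{j=1}^n x_0^j(x_0^j)^\top$. Call $K\in\mathbb R^{m\times n}$ stabilizing if $A_K:=A-BK$ is Hurwitz, i.e. all its eigenvalues have negative real part. For stabilizing $K$ let $X(K)$ and $Y(K)$ be the unique solutions of $$A_K^\top X+XA_K+K^\top RK+Q=0,\qquad A_KY+YA_K^\top+\Sigma=0,$$ and put $N(K)=RK-B^\top X(K)$ and $f(K)=\operatorname{Tr}(X(K)\Sigma)$, the continuous-time LQR cost summed over the initial conditions $x_0^1,\dots,x_0^n$ (with running cost $\langle x,Qx\rangle+\langle u,Ru\rangle$ and feedback $u=-Kx$). Let $\nabla f$ denote the gradient of $f$ with respect to the Frobenius inner product, $\lambda_{\min},\lambda_{\max}$ the smallest and largest eigenvalue of a symmetric matrix, $\|\cdot\|_2$ the spectral norm and $\|\cdot\|_F$ the Frobenius norm. Let $K_0$ be stabilizing, and let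 $K_{j+1}=K_j-\eta_j\nabla f(K_j)$ for $j\ge 0$, where $\eta_j=\sqrt{\frac{1}{3d_j}+\frac19}-\frac13$, $d_j=\max(b_j,c_j)$ and $$b_j=\frac{f(K_j)\,\lambda_{\max}(R)}{\lambda_{\min}(Q)}+\frac{4\,\|B\,N(K_j)\,Y(K_j)\|_2\,f(K_j)}{\lambda_{\min}(Q)\,\lambda_{\min}(\Sigma)},\qquad c_j=\frac{4\,\lambda_{\min}(R)\,\|B\,N(K_j)\,Y(K_j)\|_2\,f(K_j)}{\lambda_{\min}(Q)\,\lambda_{\min}(\Sigma)}.$$ Then every $K_j$ is stabilizing. Moreover $f$ has a unique global minimizer $K_*$ over the stabilizing gains, and there are constants $q\in(0,1)$ and $c_1>0$ such that for all $j\ge 0$ $$f(K_j)-f(K_*)\le q^j\,(f(K_0)-f(K_*))\qquad\text{and}\qquad \|K_j-K_*\|_F\le c_1\,q^{j/2}.$$ -/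

import Mathlib

open scoped Matrix

noncomputable section

namespace LQR

/-- A real square matrix is Hurwitz (stable) if all its complex eigenvalues have negative real
part. -/
def IsHurwitz {n : ℕ} (A : Matrix (Fin n) (Fin n) ℝ) : Prop :=
  ∀ z ∈ spectrum ℂ (A.map (algebraMap ℝ ℂ)), z.re < 0

open Classical in
/-- The solution `X` of the Lyapunov equation `Aᵀ X + X A + Q = 0`. For Hurwitz `A` the solution
exists and is unique; the value is irrelevant (zero) when there is no solution. -/
def lyapunovSolution {n : ℕ} (A Q : Matrix (Fin n) (Fin n) ℝ) : Matrix (Fin n) (Fin n) ℝ :=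
  if h : ∃ X : Matrix (Fin n) (Fin n) ℝ, Aᵀ * X + X * A + Q = 0 then h.choose else 0

/-- The smallest eigenvalue of a (symmetric, nonempty) real matrix. -/
def lambdaMin {k : ℕ} (M : Matrix (Fin k) (Fin k) ℝ) : ℝ := sInf (spectrum ℝ M)

/-- The largest eigenvalue of a (symmetric, nonempty) real matrix. -/
def lambdaMax {k : ℕ} (M : Matrix (Fin k) (Fin k) ℝ) : ℝ := sSup (spectrum ℝ M)

/-- The spectral norm of a square matrix: operator norm for the Euclidean vector norm. -/
def spectralNorm {k : ℕ} (M : Matrix (Fin k) (Fin k) ℝ) : ℝ :=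
  ‖Matrix.toEuclideanCLM (n := Fin k) (𝕜 := ℝ) M‖

/-- The Frobenius norm of a matrix. -/
def frobeniusNorm {k l : ℕ} (M : Matrix (Fin k) (Fin l) ℝ) : ℝ :=
  Real.sqrt (∑ i, ∑ j, M i j ^ 2)

/-- The data of a continuous-time linear-quadratic regulator problem: the system
`x' = A x + B u`, the weights `Q`, `R` of the running cost `⟨x, Q x⟩ + ⟨u, R u⟩`, and `n` initial
conditions `x₀ 0, …, x₀ (n - 1)` over which the cost is summed. -/
structure Problem (n m : ℕ) where
  A : Matrix (Fin n) (Fin n) ℝ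
  B : Matrix (Fin n) (Fin m) ℝ
  Q : Matrix (Fin n) (Fin n) ℝ
  R : Matrix (Fin m) (Fin m) ℝ
  x₀ : Fin n → Fin n → ℝ

namespace Problem

variable {n m : ℕ} (P : Problem n m)

/-- The closed-loop matrix `A_K = A - B K`. -/
def closedLoop (K : Matrix (Fin m) (Fin n) ℝ) : Matrix (Fin n) (Fin n) ℝ := P.A - P.B * K

/-- The set of (Hurwitz) stabilizing feedback gains. -/
def stabilizing : Set (Matrix (Fin m) (Fin n) ℝ) := {K | IsHurwitz (P.closedLoop K)}

/-- `Σ = ∑ j, x₀ʲ (x₀ʲ)ᵀ`. -/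
def Sig : Matrix (Fin n) (Fin n) ℝ := ∑ j, Matrix.vecMulVec (P.x₀ j) (P.x₀ j)

/-- The value matrix `X(K)`: `A_Kᵀ X + X A_K + Kᵀ R K + Q = 0`. -/
def X (K : Matrix (Fin m) (Fin n) ℝ) : Matrix (Fin n) (Fin n) ℝ :=
  lyapunovSolution (P.closedLoop K) (Kᵀ * P.R * K + P.Q)

/-- The matrix `Y(K)`: `A_K Y + Y A_Kᵀ + Σ = 0`. -/
def Y (K : Matrix (Fin m) (Fin n) ℝ) : Matrix (Fin n) (Fin n) ℝ :=
  lyapunovSolution (P.closedLoop K)ᵀ P.Sig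

/-- `N_K = R K - Bᵀ X(K)`. -/
def N (K : Matrix (Fin m) (Fin n) ℝ) : Matrix (Fin m) (Fin n) ℝ := P.R * K - P.Bᵀ * P.X K

/-- The cost `f(K) = Tr(X(K) Σ)`, meaningful for stabilizing `K`. -/
def cost (K : Matrix (Fin m) (Fin n) ℝ) : ℝ := (P.X K * P.Sig).trace

/-- The gradient of the cost for the Frobenius inner product, i.e. the matrix of its partial
derivatives with respect to the entries of `K`. -/
def gradCost (K : Matrix (Fin m) (Fin n) ℝ) : Matrix (Fin m) (Fin n) ℝ :=
  Matrix.of fun i j => deriv (fun t : ℝ => P.cost (K + t • Matrix.single i j (1 : ℝ))) 0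

/-- `b(K) = f(K) λ_max(R) / λ₁(Q) + 4 ‖B N_K Y_K‖₂ f(K) / (λ₁(Q) λ₁(Σ))`. -/
def bConst (K : Matrix (Fin m) (Fin n) ℝ) : ℝ :=
  P.cost K * lambdaMax P.R / lambdaMin P.Q +
    4 * spectralNorm (P.B * P.N K * P.Y K) * P.cost K / (lambdaMin P.Q * lambdaMin P.Sig)

/-- `c(K) = 4 λ₁(R) ‖B N_K Y_K‖₂ f(K) / (λ₁(Q) λ₁(Σ))`. -/
def cConst (K : Matrix (Fin m) (Fin n) ℝ) : ℝ :=
  4 * lambdaMin P.R * spectralNorm (P.B * P.N K * P.Y K) * P.cost K /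
    (lambdaMin P.Q * lambdaMin P.Sig)

/-- `d(K) = max (b(K), c(K))`. -/
def dConst (K : Matrix (Fin m) (Fin n) ℝ) : ℝ := max (P.bConst K) (P.cConst K)

/-- The stepsize `η(K) = √(1 / (3 d(K)) + 1 / 9) - 1 / 3`. -/
def stepsize (K : Matrix (Fin m) (Fin n) ℝ) : ℝ :=
  Real.sqrt (1 / (3 * P.dConst K) + 1 / 9) - 1 / 3

end Problem

end LQR

end

namespace LQR

/-! ### Trace inequalities for positive semidefinite matrices -/

section TraceInequalities

variable {ι κ : Type*} [Fintype ι] [Fintype κ]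

open Matrix

/-! The gradient is `2 • (N * Y)` (`gradCost_eq`), so a step moves `K` by `-(2η)W` with `W = N Y`.
Two facts about one step are needed, both algebraic consequences of Lyapunov equations. First,
`Y(K)` itself is a Lyapunov certificate for the new closed loop: the step changes the Lyapunov
expression by at most `x Σ` with `x = 4ηsτ/λ_min(Σ) < 1`, where `s` is the spectral norm of `B N Y`
and `τ = f/λ_min(Q)` bounds `tr Y`. Second, the cost drops by at least a multiple of `g = ‖W‖_F²`
(`trace_descent`, `gradient_step`). No second derivative along the segment is used: the value
difference `D = X(K) - X(K₊)` solves an exact Lyapunov equation, and pairing it with `Y` and with `D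
Y D` controls the error terms.

Globally, a sublevel set of the cost bounds `K`, `X`, `Y` and bounds `Y` away from zero
(`exists_sublevel_bounds`), so step sizes stay bounded below. The decreases telescope, the gradients
tend to zero, and compactness yields a stationary gain with `N = 0` (`exists_stationary`). The exact
difference formula `cost_sub` then gives quadratic growth around that gain, hence unique minimality,
and, after completing a square, the domination `f(K) - f(K_*) ≤ G g`. Together with `h g ≤ f(K) -
f(K₊)` this is linear convergence of the cost, and quadratic growth transfers the rate to the gains.
-/

lemma posSemidef_iff_real {M : Matrix ι ι ℝ} :
    M.PosSemidef ↔ Mᵀ = M ∧ ∀ x : ι → ℝ, 0 ≤ x ⬝ᵥ M *ᵥ x := by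
  rw [posSemidef_iff_dotProduct_mulVec, IsHermitian, conjTranspose_eq_transpose_of_trivial]
  simp

lemma posDef_iff_real {M : Matrix ι ι ℝ} :
    M.PosDef ↔ Mᵀ = M ∧ ∀ x : ι → ℝ, x ≠ 0 → 0 < x ⬝ᵥ M *ᵥ x := by
  rw [posDef_iff_dotProduct_mulVec, IsHermitian, conjTranspose_eq_transpose_of_trivial]
  simp

lemma _root_.Matrix.PosSemidef.transpose_eq {M : Matrix ι ι ℝ} (h : M.PosSemidef) : Mᵀ = M :=
  (posSemidef_iff_real.1 h).1

lemma _root_.Matrix.PosDef.transpose_eq {M : Matrix ι ι ℝ} (h : M.PosDef) : Mᵀ = M :=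
  (posDef_iff_real.1 h).1

lemma posSemidef_conj {M : Matrix ι ι ℝ} (h : M.PosSemidef) (C : Matrix κ ι ℝ) :
    (C * M * Cᵀ).PosSemidef := by
  simpa using h.mul_mul_conjTranspose_same C

lemma posSemidef_mul_transpose (C : Matrix κ ι ℝ) : (C * Cᵀ).PosSemidef := by
  simpa using posSemidef_self_mul_conjTranspose C

lemma posSemidef_transpose_mul (C : Matrix κ ι ℝ) : (Cᵀ * C).PosSemidef := by
  simpa using posSemidef_conjTranspose_mul_self C

lemma posSemidef_exists_factor {M : Matrix ι ι ℝ} (h : M.PosSemidef) :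
    ∃ L : Matrix ι ι ℝ, M = Lᵀ * L := by
  classical
  open scoped MatrixOrder in
  obtain ⟨B, hB⟩ := CStarAlgebra.nonneg_iff_eq_star_mul_self.mp h.nonneg
  exact ⟨B, by simpa [star_eq_conjTranspose] using hB⟩

lemma trace_mul_nonneg {M G : Matrix ι ι ℝ} (hM : M.PosSemidef) (hG : G.PosSemidef) :
    0 ≤ (M * G).trace := by
  obtain ⟨L, rfl⟩ := posSemidef_exists_factor hM
  rw [Matrix.mul_assoc, trace_mul_comm]
  exact (posSemidef_conj hG L).trace_nonneg

lemma trace_mul_le [DecidableEq ι] {M G : Matrix ι ι ℝ} {c : ℝ} (hM : M.PosSemidef)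
    (hG : (c • (1 : Matrix ι ι ℝ) - G).PosSemidef) : (M * G).trace ≤ c * M.trace := by
  have := trace_mul_nonneg hM hG
  simpa [Matrix.mul_sub, trace_sub, trace_smul] using this

lemma le_trace_mul [DecidableEq ι] {M G : Matrix ι ι ℝ} {c : ℝ} (hM : M.PosSemidef)
    (hG : (G - c • (1 : Matrix ι ι ℝ)).PosSemidef) : c * M.trace ≤ (M * G).trace := by
  have := trace_mul_nonneg hM hG
  simpa [Matrix.mul_sub, trace_sub, trace_smul] using this

/-- Cauchy–Schwarz for the semi-inner product `tr (P Y Qᵀ)`. -/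
lemma trace_cauchySchwarz {Y : Matrix ι ι ℝ} (hY : Y.PosSemidef) (P Q : Matrix κ ι ℝ) :
    (P * Y * Qᵀ).trace ^ 2 ≤ (P * Y * Pᵀ).trace * (Q * Y * Qᵀ).trace := by
  have hsym : (Q * Y * Pᵀ).trace = (P * Y * Qᵀ).trace := by
    rw [← trace_transpose]; simp [hY.transpose_eq, Matrix.mul_assoc]
  have h : ∀ t : ℝ, 0 ≤ (Q * Y * Qᵀ).trace * (t * t) + (2 * (P * Y * Qᵀ).trace) * t
      + (P * Y * Pᵀ).trace := fun t ↦ by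
    have := (posSemidef_conj hY (P + t • Q)).trace_nonneg
    simp only [Matrix.add_mul, transpose_add, transpose_smul, Matrix.mul_add, smul_mul,
      Matrix.mul_smul, trace_add, trace_smul, smul_eq_mul, hsym] at this
    linarith
  have := discrim_le_zero h
  rw [discrim] at this
  linarith

lemma trace_cauchySchwarz_abs {Y : Matrix ι ι ℝ} (hY : Y.PosSemidef) (P Q : Matrix κ ι ℝ)
    {a b : ℝ} (ha : 0 ≤ a) (hb : 0 ≤ b) (hP : (P * Y * Pᵀ).trace ≤ a ^ 2)
    (hQ : (Q * Y * Qᵀ).trace ≤ b ^ 2) : |(P * Y * Qᵀ).trace| ≤ a * b := by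
  apply abs_le_of_sq_le_sq _ (mul_nonneg ha hb)
  calc _ ≤ _ := trace_cauchySchwarz hY P Q
    _ ≤ a ^ 2 * b ^ 2 := mul_le_mul hP hQ (posSemidef_conj hY Q).trace_nonneg (sq_nonneg a)
    _ = _ := by ring

/-- Factor `Y = Lᵀ L` and apply Cauchy–Schwarz to each row of `L`. The trace thus serves as a cheap
substitute for the largest eigenvalue. -/
lemma posSemidef_smul_one_sub_of_trace_le [DecidableEq ι] {Y : Matrix ι ι ℝ} (hY : Y.PosSemidef)
    {τ : ℝ} (h : Y.trace ≤ τ) : (τ • (1 : Matrix ι ι ℝ) - Y).PosSemidef := by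
  refine posSemidef_iff_real.2 ⟨by simp [hY.transpose_eq], fun x ↦ ?_⟩
  have h0 := hY.trace_nonneg
  have key : x ⬝ᵥ Y *ᵥ x ≤ Y.trace * (x ⬝ᵥ x) := by
    obtain ⟨L, rfl⟩ := posSemidef_exists_factor hY
    rw [← mulVec_mulVec, dotProduct_mulVec, vecMul_transpose, Matrix.trace_mul_comm]
    simp only [dotProduct, mulVec, trace, diag_apply, mul_apply, transpose_apply]
    rw [Finset.sum_mul]
    refine Finset.sum_le_sum fun i _ ↦ ?_
    have := Finset.sum_mul_sq_le_sq_mul_sq Finset.univ (fun j ↦ L i j) x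
    simpa [sq] using this
  have hx : 0 ≤ x ⬝ᵥ x := by
    simp only [dotProduct]; exact Finset.sum_nonneg fun i _ ↦ mul_self_nonneg _
  simp only [sub_mulVec, smul_mulVec, one_mulVec, dotProduct_sub, dotProduct_smul, smul_eq_mul]
  nlinarith

lemma posSemidef_smul_one_sub_conj [DecidableEq ι] [DecidableEq κ] {Y : Matrix ι ι ℝ} {a b : ℝ}
    (ha : 0 ≤ a) {C : Matrix κ ι ℝ} (hY : (a • (1 : Matrix ι ι ℝ) - Y).PosSemidef)
    (hC : (b • (1 : Matrix κ κ ℝ) - C * Cᵀ).PosSemidef) :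
    ((a * b) • (1 : Matrix κ κ ℝ) - C * Y * Cᵀ).PosSemidef := by
  have := (posSemidef_conj hY C).add (hC.smul ha)
  convert this using 1
  simp [Matrix.mul_sub, Matrix.sub_mul, smul_sub, smul_smul]

end TraceInequalities

/-! ### Lyapunov equations and stability -/

section Lyapunov

open Matrix Filter Topology

variable {n : ℕ}

lemma exists_mulVec_eq_smul_of_mem_spectrum {ι 𝕜 : Type*} [Fintype ι] [DecidableEq ι] [Field 𝕜]
    {M : Matrix ι ι 𝕜} {z : 𝕜} (hz : z ∈ spectrum 𝕜 M) : ∃ v ≠ 0, M *ᵥ v = z • v := by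
  rw [spectrum.mem_iff, isUnit_iff_isUnit_det, isUnit_iff_ne_zero, not_not] at hz
  obtain ⟨v, hv, h⟩ := exists_mulVec_eq_zero_iff.2 hz
  refine ⟨v, hv, ?_⟩
  rw [sub_mulVec, sub_eq_zero, Algebra.algebraMap_eq_smul_one, smul_mulVec, one_mulVec] at h
  exact h.symm

lemma mem_spectrum_of_mulVec_eq_smul {ι 𝕜 : Type*} [Fintype ι] [DecidableEq ι] [Field 𝕜]
    {M : Matrix ι ι 𝕜} {z : 𝕜} {v : ι → 𝕜} (hv : v ≠ 0) (h : M *ᵥ v = z • v) :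
    z ∈ spectrum 𝕜 M := by
  rw [spectrum.mem_iff, isUnit_iff_isUnit_det, isUnit_iff_ne_zero, not_not]
  refine exists_mulVec_eq_zero_iff.1 ⟨v, hv, ?_⟩
  rw [sub_mulVec, sub_eq_zero, Algebra.algebraMap_eq_smul_one, smul_mulVec, one_mulVec, h]

lemma mem_spectrum_transpose_iff {ι 𝕜 : Type*} [Fintype ι] [DecidableEq ι] [Field 𝕜]
    {M : Matrix ι ι 𝕜} {z : 𝕜} : z ∈ spectrum 𝕜 Mᵀ ↔ z ∈ spectrum 𝕜 M := by
  have : algebraMap 𝕜 (Matrix ι ι 𝕜) z - Mᵀ = (algebraMap 𝕜 (Matrix ι ι 𝕜) z - M)ᵀ := by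
    simp [Algebra.algebraMap_eq_smul_one]
  rw [spectrum.mem_iff, spectrum.mem_iff, this, isUnit_transpose]

lemma IsHurwitz.transpose {A : Matrix (Fin n) (Fin n) ℝ} (hA : IsHurwitz A) : IsHurwitz Aᵀ :=
  fun z hz ↦ hA z (mem_spectrum_transpose_iff.1 (by rwa [transpose_map] at hz))

/-- Lyapunov's criterion for stability. -/
lemma isHurwitz_of_posDef {A Y : Matrix (Fin n) (Fin n) ℝ} (hY : Y.PosDef)
    (hS : (-(A * Y + Y * Aᵀ)).PosDef) : IsHurwitz A := by
  intro z hz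
  obtain ⟨v, hv, h⟩ := exists_mulVec_eq_smul_of_mem_spectrum (mem_spectrum_transpose_iff.2 hz)
  -- With `v = a + ib` a left eigenvector of `A`, adding the quadratic forms at `a` and `b` gives
  -- the Hermitian form at `v`, where the Lyapunov expression equals `2 Re z` times that of `Y`.
  set a : Fin n → ℝ := fun i ↦ (v i).re with ha
  set b : Fin n → ℝ := fun i ↦ (v i).im with hb
  have hva : Aᵀ *ᵥ a = z.re • a - z.im • b := by
    ext i
    have := congrArg Complex.re (congrFun h i)
    simpa [mulVec, dotProduct, ha, hb] using this
  have hvb : Aᵀ *ᵥ b = z.re • b + z.im • a := by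
    ext i
    have := congrArg Complex.im (congrFun h i)
    simpa [mulVec, dotProduct, ha, hb] using this
  have hq : ∀ x : Fin n → ℝ, x ⬝ᵥ (A * Y + Y * Aᵀ) *ᵥ x = 2 * ((Aᵀ *ᵥ x) ⬝ᵥ Y *ᵥ x) := by
    intro x
    have h1 : x ⬝ᵥ (A * Y) *ᵥ x = (Aᵀ *ᵥ x) ⬝ᵥ Y *ᵥ x := by
      rw [← mulVec_mulVec, dotProduct_mulVec, mulVec_transpose]
    have h2 : x ⬝ᵥ (Y * Aᵀ) *ᵥ x = (Aᵀ *ᵥ x) ⬝ᵥ Y *ᵥ x := by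
      rw [← mulVec_mulVec, dotProduct_mulVec, ← mulVec_transpose, hY.transpose_eq, dotProduct_comm]
    rw [add_mulVec, dotProduct_add, h1, h2, two_mul]
  have hcomm : b ⬝ᵥ Y *ᵥ a = a ⬝ᵥ Y *ᵥ b := by
    rw [dotProduct_mulVec, ← mulVec_transpose, hY.transpose_eq, dotProduct_comm]
  have hSq := (posDef_iff_real.1 hS).2
  have hYq := (posDef_iff_real.1 hY).2
  have hS0 : ∀ x, 0 ≤ x ⬝ᵥ (-(A * Y + Y * Aᵀ)) *ᵥ x := (posSemidef_iff_real.1 hS.posSemidef).2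
  have hY0 := (posSemidef_iff_real.1 hY.posSemidef).2
  have hab : a ≠ 0 ∨ b ≠ 0 := by
    by_contra! hcon
    refine hv (funext fun i ↦ Complex.ext ?_ ?_)
    · simpa using congrFun hcon.1 i
    · simpa using congrFun hcon.2 i
  have sum_eq : a ⬝ᵥ (-(A * Y + Y * Aᵀ)) *ᵥ a + b ⬝ᵥ (-(A * Y + Y * Aᵀ)) *ᵥ b
      = -(2 * z.re) * (a ⬝ᵥ Y *ᵥ a + b ⬝ᵥ Y *ᵥ b) := by
    rw [neg_mulVec, neg_mulVec, dotProduct_neg, dotProduct_neg, hq, hq, hva, hvb]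
    simp only [sub_dotProduct, add_dotProduct, smul_dotProduct, smul_eq_mul, hcomm]
    ring
  have hpos : 0 < a ⬝ᵥ (-(A * Y + Y * Aᵀ)) *ᵥ a + b ⬝ᵥ (-(A * Y + Y * Aᵀ)) *ᵥ b := by
    rcases hab with h | h
    · linarith [hSq a h, hS0 b]
    · linarith [hSq b h, hS0 a]
  have hYpos : 0 ≤ a ⬝ᵥ Y *ᵥ a + b ⬝ᵥ Y *ᵥ b := add_nonneg (hY0 a) (hY0 b)
  rw [sum_eq] at hpos
  by_contra! hz0
  nlinarith

-- Gelfand's formula: the `k`-th root of the norm of the `k`-th power tends to a spectral radius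
-- below one, so the powers decay geometrically over `ℂ`, and real parts recover the real matrix.
open scoped Matrix.Norms.Operator in
lemma tendsto_pow_zero_of_spectrum {C : Matrix (Fin n) (Fin n) ℝ}
    (hC : ∀ z ∈ spectrum ℂ (C.map (algebraMap ℝ ℂ)), ‖z‖ < 1) (i j : Fin n) :
    Tendsto (fun k : ℕ ↦ (C ^ k) i j) atTop (𝓝 0) := by
  set D := C.map (algebraMap ℝ ℂ) with hD
  have hr : spectralRadius ℂ D < 1 := by
    rcases (spectrum ℂ D).eq_empty_or_nonempty with h | h
    · simp [spectralRadius, h]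
    · exact_mod_cast spectrum.spectralRadius_lt_of_forall_lt_of_nonempty h (r := 1)
        fun z hz ↦ by exact_mod_cast hC z hz
  obtain ⟨r, hr1, hr2⟩ := exists_between hr
  have hr' : r ≠ ⊤ := (hr2.trans ENNReal.one_lt_top).ne
  lift r to NNReal using hr'
  have hr3 : r < 1 := by exact_mod_cast hr2
  have hev := (spectrum.pow_nnnorm_pow_one_div_tendsto_nhds_spectralRadius D).eventually_lt_const hr1
  have hD0 : Tendsto (fun k ↦ D ^ k) atTop (𝓝 0) := by
    refine squeeze_zero_norm' ?_
      (tendsto_pow_atTop_nhds_zero_of_lt_one (r := (r : ℝ)) r.2 hr3)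
    filter_upwards [hev, eventually_gt_atTop 0] with k hk hk0
    have hk1 : (0 : ℝ) < k := by exact_mod_cast hk0
    have := ENNReal.rpow_le_rpow hk.le hk1.le
    rw [← ENNReal.rpow_mul, one_div_mul_cancel hk1.ne', ENNReal.rpow_one, ENNReal.rpow_natCast]
      at this
    exact_mod_cast this
  have h1 := tendsto_pi_nhds.1 (tendsto_pi_nhds.1 hD0 i) j
  have h2 := (Complex.continuous_re.tendsto _).comp h1
  refine (h2.congr fun k ↦ ?_)
  have : D ^ k = (C ^ k).map (algebraMap ℝ ℂ) := (Matrix.map_pow C (algebraMap ℝ ℂ) k).symm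
  simp [this]

/-- The Cayley transform of a Hurwitz matrix is power-stable. -/
lemma IsHurwitz.exists_cayley {A : Matrix (Fin n) (Fin n) ℝ} (hA : IsHurwitz A) :
    IsUnit (1 - A) ∧ ∀ i j, Tendsto (fun k : ℕ ↦ (((1 - A)⁻¹ * (1 + A)) ^ k) i j) atTop (𝓝 0) := by
  have hmap : (1 - A).map (algebraMap ℝ ℂ) = 1 - A.map (algebraMap ℝ ℂ) := by
    ext i j; simp [Matrix.one_apply]; split_ifs <;> simp
  have hmap' : (1 + A).map (algebraMap ℝ ℂ) = 1 + A.map (algebraMap ℝ ℂ) := by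
    ext i j; simp [Matrix.one_apply]; split_ifs <;> simp
  have hu : IsUnit (1 - A) := by
    have h1 : (1 : ℂ) ∉ spectrum ℂ (A.map (algebraMap ℝ ℂ)) := fun h ↦ by
      have := hA 1 h; norm_num at this
    rw [spectrum.notMem_iff, map_one, ← hmap, isUnit_iff_isUnit_det,
      ← RingHom.mapMatrix_apply, ← RingHom.map_det] at h1
    rw [isUnit_iff_isUnit_det]
    simpa using h1
  refine ⟨hu, fun i j ↦ tendsto_pow_zero_of_spectrum (fun μ hμ ↦ ?_) i j⟩
  obtain ⟨v, hv, h⟩ := exists_mulVec_eq_smul_of_mem_spectrum hμ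
  set Ac := A.map (algebraMap ℝ ℂ) with hAc
  have hmul : (1 - Ac) * ((1 - A)⁻¹ * (1 + A)).map (algebraMap ℝ ℂ) = 1 + Ac := by
    rw [← hmap, ← Matrix.map_mul, ← Matrix.mul_assoc,
      Matrix.mul_nonsing_inv _ ((isUnit_iff_isUnit_det _).1 hu), Matrix.one_mul, hmap']
  have hv1 : v + Ac *ᵥ v = μ • (v - Ac *ᵥ v) := by
    have := congrArg (fun M ↦ M *ᵥ v) hmul
    simp only [← mulVec_mulVec, h, add_mulVec, one_mulVec] at this
    rw [← this, mulVec_smul, sub_mulVec, one_mulVec]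
  have hv2 : (μ + 1) • (Ac *ᵥ v) = (μ - 1) • v := by
    ext i
    have := congrFun hv1 i
    simp only [Pi.add_apply, Pi.smul_apply, Pi.sub_apply, smul_eq_mul] at this ⊢
    linear_combination this
  -- At `μ = -1` the relation would read `0 = -2v`.
  have hμ1 : μ + 1 ≠ 0 := fun h0 ↦ by
    have hm : μ - 1 = -2 := by linear_combination h0
    rw [h0, zero_smul, hm] at hv2
    exact hv ((smul_eq_zero.1 hv2.symm).resolve_left (by norm_num))
  -- An eigenvalue `μ` of the Cayley transform comes from the eigenvalue `(μ - 1)/(μ + 1)` of `A`,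
  -- whose real part is negative exactly when `|μ| < 1`.
  have hz := hA ((μ - 1) / (μ + 1)) (mem_spectrum_of_mulVec_eq_smul hv (by
    rw [div_eq_inv_mul, ← smul_smul, ← hv2, smul_smul, inv_mul_cancel₀ hμ1, one_smul]))
  have hns : 0 < Complex.normSq (μ + 1) := Complex.normSq_pos.2 hμ1
  rw [Complex.div_re, ← add_div, div_neg_iff] at hz
  have h3 : μ.re * μ.re + μ.im * μ.im < 1 := by
    rcases hz with hz | hz
    · linarith [hz.2]
    · have := hz.1; simp at this; nlinarith
  rw [← Complex.normSq_apply, Complex.normSq_eq_norm_sq] at h3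
  nlinarith [norm_nonneg μ]

lemma tendsto_quadratic_zero {C : Matrix (Fin n) (Fin n) ℝ}
    (hC : ∀ i j, Tendsto (fun k : ℕ ↦ (C ^ k) i j) atTop (𝓝 0)) (Y : Matrix (Fin n) (Fin n) ℝ) :
    Tendsto (fun k : ℕ ↦ C ^ k * Y * (C ^ k)ᵀ) atTop (𝓝 0) := by
  have h0 : Tendsto (fun k : ℕ ↦ C ^ k) atTop (𝓝 0) :=
    tendsto_pi_nhds.2 fun i ↦ tendsto_pi_nhds.2 fun j ↦ hC i j
  have hc : Continuous fun M : Matrix (Fin n) (Fin n) ℝ ↦ M * Y * Mᵀ := by fun_prop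
  have := (hc.tendsto 0).comp h0
  simpa [Function.comp_def] using this

/-- Turns the continuous equation into a discrete one `Y = C Y Cᵀ + G` with `C` power-stable.
Iterating it replaces the integral of `exp(tA) S exp(tAᵀ)`. -/
lemma IsHurwitz.cayley_identity {A Y S : Matrix (Fin n) (Fin n) ℝ} (hA : IsHurwitz A)
    (h : A * Y + Y * Aᵀ + S = 0) :
    Y = ((1 - A)⁻¹ * (1 + A)) * Y * ((1 - A)⁻¹ * (1 + A))ᵀ
      + (2 : ℝ) • ((1 - A)⁻¹ * S * ((1 - A)⁻¹)ᵀ) := by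
  have hd := (isUnit_iff_isUnit_det _).1 hA.exists_cayley.1
  have hl : (1 - A)⁻¹ * (1 - A) = 1 := nonsing_inv_mul _ hd
  have hr : (1 - A)ᵀ * ((1 - A)⁻¹)ᵀ = 1 := by rw [← transpose_mul, hl, transpose_one]
  have hS : (2 : ℝ) • S = (1 - A) * Y * (1 - A)ᵀ - (1 + A) * Y * (1 + A)ᵀ := by
    rw [show S = -(A * Y + Y * Aᵀ) from (neg_eq_of_add_eq_zero_right h).symm]
    simp only [transpose_sub, transpose_add, transpose_one, two_smul]
    noncomm_ring
  calc Y = ((1 - A)⁻¹ * (1 - A)) * Y * ((1 - A)ᵀ * ((1 - A)⁻¹)ᵀ) := by rw [hl, hr]; simp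
    _ = (1 - A)⁻¹ * ((1 - A) * Y * (1 - A)ᵀ) * ((1 - A)⁻¹)ᵀ := by simp only [Matrix.mul_assoc]
    _ = (1 - A)⁻¹ * ((1 + A) * Y * (1 + A)ᵀ + (2 : ℝ) • S) * ((1 - A)⁻¹)ᵀ := by rw [hS]; simp
    _ = _ := by
      rw [Matrix.mul_add, Matrix.add_mul, Matrix.mul_smul, Matrix.smul_mul, transpose_mul]
      simp only [Matrix.mul_assoc]

lemma IsHurwitz.eq_zero_of_lyapunov {A Y : Matrix (Fin n) (Fin n) ℝ} (hA : IsHurwitz A)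
    (h : A * Y + Y * Aᵀ = 0) : Y = 0 := by
  have hc := hA.cayley_identity (S := 0) (by simpa using h)
  simp only [Matrix.mul_zero, Matrix.zero_mul, smul_zero, add_zero] at hc
  have ht := hA.exists_cayley.2
  generalize (1 - A)⁻¹ * (1 + A) = C at hc ht
  have hk : ∀ k : ℕ, Y = C ^ k * Y * (C ^ k)ᵀ := by
    intro k
    induction k with
    | zero => simp
    | succ k ih =>
      conv_lhs => rw [ih, hc]
      rw [pow_succ, transpose_mul]
      simp only [Matrix.mul_assoc]
  refine tendsto_nhds_unique ?_ (tendsto_quadratic_zero ht Y)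
  exact tendsto_const_nhds.congr hk

lemma IsHurwitz.lyapunov_unique {A S Y Z : Matrix (Fin n) (Fin n) ℝ} (hA : IsHurwitz A)
    (hY : A * Y + Y * Aᵀ + S = 0) (hZ : A * Z + Z * Aᵀ + S = 0) : Y = Z := by
  refine sub_eq_zero.1 (hA.eq_zero_of_lyapunov ?_)
  rw [Matrix.mul_sub, Matrix.sub_mul, ← sub_eq_zero.2 (hY.trans hZ.symm)]
  abel

/-- The Lyapunov operator `Y ↦ A Y + Y Aᵀ`. -/
noncomputable def lyapunovMap (A : Matrix (Fin n) (Fin n) ℝ) :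
    Matrix (Fin n) (Fin n) ℝ →ₗ[ℝ] Matrix (Fin n) (Fin n) ℝ :=
  LinearMap.mulLeft ℝ A + LinearMap.mulRight ℝ Aᵀ

lemma lyapunovMap_apply (A Y : Matrix (Fin n) (Fin n) ℝ) :
    lyapunovMap A Y = A * Y + Y * Aᵀ := rfl

/-- Uniqueness makes the Lyapunov operator injective, hence surjective in finite dimension. -/
lemma IsHurwitz.exists_lyapunov {A : Matrix (Fin n) (Fin n) ℝ} (hA : IsHurwitz A)
    (S : Matrix (Fin n) (Fin n) ℝ) : ∃ Y, A * Y + Y * Aᵀ + S = 0 := by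
  have hinj : Function.Injective (lyapunovMap A) := by
    rw [← LinearMap.ker_eq_bot, LinearMap.ker_eq_bot']
    exact fun Y hY ↦ hA.eq_zero_of_lyapunov hY
  obtain ⟨Y, hY⟩ := LinearMap.injective_iff_surjective.1 hinj (-S)
  exact ⟨Y, by rw [← lyapunovMap_apply, hY, neg_add_cancel]⟩

lemma IsHurwitz.lyapunov_symm {A S Y : Matrix (Fin n) (Fin n) ℝ} (hA : IsHurwitz A)
    (hS : Sᵀ = S) (hY : A * Y + Y * Aᵀ + S = 0) : Yᵀ = Y := by
  refine hA.lyapunov_unique (S := S) ?_ hY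
  have := congrArg Matrix.transpose hY
  simp only [transpose_add, transpose_mul, transpose_transpose, hS, transpose_zero] at this
  rw [← this]; abel

lemma IsHurwitz.lyapunov_posSemidef {A S Y : Matrix (Fin n) (Fin n) ℝ} (hA : IsHurwitz A)
    (hS : S.PosSemidef) (hY : A * Y + Y * Aᵀ + S = 0) : Y.PosSemidef := by
  have hc := hA.cayley_identity hY
  have hC := hA.exists_cayley.2
  have hG : ((2 : ℝ) • ((1 - A)⁻¹ * S * ((1 - A)⁻¹)ᵀ)).PosSemidef :=
    (posSemidef_conj hS _).smul (by norm_num)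
  generalize (1 - A)⁻¹ * (1 + A) = C at hc hC
  generalize (2 : ℝ) • ((1 - A)⁻¹ * S * ((1 - A)⁻¹)ᵀ) = G at hc hG
  -- The difference is the partial sum of the series of the `C^i G (C^i)ᵀ`; its limit is `Y`.
  have hk : ∀ k : ℕ, (Y - C ^ k * Y * (C ^ k)ᵀ).PosSemidef := by
    intro k
    induction k with
    | zero => simpa using PosSemidef.zero
    | succ k ih =>
      have h1 := ih.add (posSemidef_conj hG (C ^ k))
      convert h1 using 1
      rw [← sub_eq_of_eq_add' hc, pow_succ, transpose_mul, Matrix.mul_sub, Matrix.sub_mul]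
      simp only [Matrix.mul_assoc, sub_add_sub_cancel]
  refine posSemidef_iff_real.2 ⟨hA.lyapunov_symm hS.transpose_eq hY, fun x ↦ ?_⟩
  have ht : Tendsto (fun k : ℕ ↦ x ⬝ᵥ (Y - C ^ k * Y * (C ^ k)ᵀ) *ᵥ x) atTop
      (𝓝 (x ⬝ᵥ Y *ᵥ x)) := by
    have hcont : Continuous fun M : Matrix (Fin n) (Fin n) ℝ ↦ x ⬝ᵥ (Y - M) *ᵥ x := by fun_prop
    have := (hcont.tendsto 0).comp (tendsto_quadratic_zero hC Y)
    simpa [Function.comp_def] using this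
  exact ge_of_tendsto' ht fun k ↦ (posSemidef_iff_real.1 (hk k)).2 x

/-- A null vector of the form of `Y` lies in the kernel of `Y`, and testing the equation on it would
annihilate the form of `S` there. -/
lemma IsHurwitz.lyapunov_posDef {A S Y : Matrix (Fin n) (Fin n) ℝ} (hA : IsHurwitz A)
    (hS : S.PosDef) (hY : A * Y + Y * Aᵀ + S = 0) : Y.PosDef := by
  have hY0 := hA.lyapunov_posSemidef hS.posSemidef hY
  refine posDef_iff_real.2 ⟨hY0.transpose_eq, fun x hx ↦ ?_⟩
  refine lt_of_le_of_ne ((posSemidef_iff_real.1 hY0).2 x) fun h0 ↦ ?_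
  have hYx : Y *ᵥ x = 0 := (hY0.dotProduct_mulVec_zero_iff x).1 (by simpa using h0.symm)
  have hSx := (posDef_iff_real.1 hS).2 x hx
  have h1 : x ⬝ᵥ (A * Y) *ᵥ x = 0 := by rw [← mulVec_mulVec, hYx]; simp
  have h2 : x ⬝ᵥ (Y * Aᵀ) *ᵥ x = 0 := by
    rw [← mulVec_mulVec, dotProduct_mulVec, ← mulVec_transpose, hY0.transpose_eq, hYx]; simp
  have h3 : x ⬝ᵥ (A * Y + Y * Aᵀ + S) *ᵥ x = 0 := by rw [hY]; simp
  rw [add_mulVec, add_mulVec, dotProduct_add, dotProduct_add, h1, h2] at h3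
  linarith

end Lyapunov

/-! ### Extreme eigenvalues and spectral norm as semidefinite bounds -/

section SpectralBounds

open Matrix

variable {k : ℕ}

lemma lambdaMin_posSemidef {M : Matrix (Fin k) (Fin k) ℝ} (hM : Mᵀ = M) :
    (M - lambdaMin M • (1 : Matrix (Fin k) (Fin k) ℝ)).PosSemidef := by
  have hH : M.IsHermitian := by
    rwa [IsHermitian, conjTranspose_eq_transpose_of_trivial]
  refine posSemidef_iff_isHermitian_and_spectrum_nonneg.2
    ⟨hH.sub (isHermitian_one.smul (IsSelfAdjoint.all _)), fun z hz ↦ ?_⟩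
  rw [← Algebra.algebraMap_eq_smul_one, sub_eq_add_neg, ← map_neg, add_comm,
    ← spectrum.vadd_eq] at hz
  obtain ⟨y, hy, rfl⟩ := hz
  -- Finiteness of the spectrum is what makes the `sInf` a genuine lower bound.
  have hb : BddBelow (spectrum ℝ M) := by
    rw [hH.spectrum_real_eq_range_eigenvalues]; exact (Set.finite_range _).bddBelow
  have : lambdaMin M ≤ y := csInf_le hb hy
  simpa using this

lemma lambdaMax_posSemidef {M : Matrix (Fin k) (Fin k) ℝ} (hM : Mᵀ = M) :
    (lambdaMax M • (1 : Matrix (Fin k) (Fin k) ℝ) - M).PosSemidef := by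
  have hH : M.IsHermitian := by
    rwa [IsHermitian, conjTranspose_eq_transpose_of_trivial]
  refine posSemidef_iff_isHermitian_and_spectrum_nonneg.2
    ⟨(isHermitian_one.smul (IsSelfAdjoint.all _)).sub hH, fun z hz ↦ ?_⟩
  rw [← Algebra.algebraMap_eq_smul_one, ← spectrum.singleton_sub_eq] at hz
  obtain ⟨w, rfl, y, hy, rfl⟩ := hz
  have hb : BddAbove (spectrum ℝ M) := by
    rw [hH.spectrum_real_eq_range_eigenvalues]; exact (Set.finite_range _).bddAbove
  have : y ≤ lambdaMax M := le_csSup hb hy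
  simpa using this

lemma lambdaMin_pos (hk : 0 < k) {M : Matrix (Fin k) (Fin k) ℝ} (hM : M.PosDef) :
    0 < lambdaMin M := by
  have : Nonempty (Fin k) := ⟨⟨0, hk⟩⟩
  have hs := hM.isHermitian.spectrum_real_eq_range_eigenvalues
  have hmem : lambdaMin M ∈ spectrum ℝ M := by
    rw [lambdaMin, hs]
    exact (Set.range_nonempty _).csInf_mem (Set.finite_range _)
  rw [hs] at hmem
  obtain ⟨i, hi⟩ := hmem
  rw [← hi]
  exact hM.eigenvalues_pos i

lemma lambdaMax_pos (hk : 0 < k) {M : Matrix (Fin k) (Fin k) ℝ} (hM : M.PosDef) :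
    0 < lambdaMax M := by
  have h := (lambdaMax_posSemidef hM.transpose_eq).diag_nonneg (i := ⟨0, hk⟩)
  have h' := hM.diag_pos (i := ⟨0, hk⟩)
  simp at h
  linarith

open scoped Matrix.Norms.L2Operator in
lemma spectralNorm_mul_transpose (C : Matrix (Fin k) (Fin k) ℝ) :
    (spectralNorm C ^ 2 • (1 : Matrix (Fin k) (Fin k) ℝ) - C * Cᵀ).PosSemidef := by
  refine posSemidef_iff_real.2 ⟨by simp, fun x ↦ ?_⟩
  have h := l2_opNorm_mulVec Cᵀ (WithLp.toLp 2 x)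
  have hn : ‖Cᵀ‖ = spectralNorm C := by
    rw [← conjTranspose_eq_transpose_of_trivial, l2_opNorm_conjTranspose]; rfl
  rw [hn] at h
  have h2 := pow_le_pow_left₀ (norm_nonneg _) h 2
  rw [mul_pow, EuclideanSpace.real_norm_sq_eq, EuclideanSpace.real_norm_sq_eq] at h2
  have h3 : x ⬝ᵥ (C * Cᵀ) *ᵥ x = ∑ i, (Cᵀ *ᵥ x) i ^ 2 := by
    rw [← mulVec_mulVec, dotProduct_mulVec, ← mulVec_transpose]
    simp [dotProduct, sq]
  have h4 : x ⬝ᵥ x = ∑ i, x i ^ 2 := by simp [dotProduct, sq]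
  simp only [sub_mulVec, smul_mulVec, one_mulVec, dotProduct_sub, dotProduct_smul, smul_eq_mul,
    h3, h4]
  simpa using h2

open scoped Matrix.Norms.L2Operator in
lemma spectralNorm_transpose (C : Matrix (Fin k) (Fin k) ℝ) :
    spectralNorm Cᵀ = spectralNorm C := by
  have := l2_opNorm_conjTranspose C
  rw [conjTranspose_eq_transpose_of_trivial] at this
  exact this

lemma spectralNorm_transpose_mul (C : Matrix (Fin k) (Fin k) ℝ) :
    (spectralNorm C ^ 2 • (1 : Matrix (Fin k) (Fin k) ℝ) - Cᵀ * C).PosSemidef := by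
  simpa [spectralNorm_transpose] using spectralNorm_mul_transpose Cᵀ

lemma spectralNorm_nonneg (C : Matrix (Fin k) (Fin k) ℝ) : 0 ≤ spectralNorm C := norm_nonneg _

end SpectralBounds

/-! ### One-step decrease of the cost -/

section Descent

open Matrix

variable {ι κ : Type*} [Fintype ι] [Fintype κ]

/-- `D ↦ Aᵀ D + D A` is the adjoint of the Lyapunov operator for the trace pairing. -/
lemma trace_lyapunov_dual {A Y S : Matrix ι ι ℝ} (h : A * Y + Y * Aᵀ + S = 0)
    (D : Matrix ι ι ℝ) : (D * S).trace = -(Y * (Aᵀ * D + D * A)).trace := by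
  rw [show S = -(A * Y + Y * Aᵀ) from (neg_eq_of_add_eq_zero_right h).symm]
  rw [Matrix.mul_neg, trace_neg, Matrix.mul_add, Matrix.mul_add, trace_add, trace_add,
    ← Matrix.mul_assoc, trace_mul_comm (D * A) Y, ← Matrix.mul_assoc D Y Aᵀ, trace_mul_comm,
    trace_mul_comm (D * Y), Matrix.mul_assoc, trace_mul_comm Y (Aᵀ * D)]
  simp only [Matrix.mul_assoc]
  ring

variable [DecidableEq ι] [DecidableEq κ]

/-- With `Y = Lᵀ L`, conjugate `L Lᵀ ≤ τ` by `Lᵀ`. -/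
lemma posSemidef_smul_sub_sq {Y : Matrix ι ι ℝ} (hY : Y.PosSemidef) {τ : ℝ} (h : Y.trace ≤ τ) :
    (τ • Y - Y * Y).PosSemidef := by
  obtain ⟨L, rfl⟩ := posSemidef_exists_factor hY
  have h1 : (L * Lᵀ).trace ≤ τ := by rwa [trace_mul_comm]
  have := posSemidef_conj
    (posSemidef_smul_one_sub_of_trace_le (posSemidef_mul_transpose L) h1) Lᵀ
  convert this using 1
  simp [Matrix.mul_sub, Matrix.sub_mul, Matrix.mul_assoc]

lemma posSemidef_sq_le {Y : Matrix ι ι ℝ} (hY : Y.PosSemidef) {τ : ℝ} (h : Y.trace ≤ τ) :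
    (τ ^ 2 • (1 : Matrix ι ι ℝ) - Y * Y).PosSemidef := by
  have h0 : 0 ≤ τ := hY.trace_nonneg.trans h
  have := ((posSemidef_smul_one_sub_of_trace_le hY h).smul h0).add (posSemidef_smul_sub_sq hY h)
  convert this using 1
  simp [smul_sub, smul_smul, sq]

lemma trace_sq_le {G : Matrix ι ι ℝ} (hG : G.PosSemidef) : (G * G).trace ≤ G.trace ^ 2 := by
  rw [sq]; exact trace_mul_le hG (posSemidef_smul_one_sub_of_trace_le hG le_rfl)

/-- One-step decrease of the cost along a scaled gradient direction `W = N Y`: here `D` is the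
difference of the value matrices before and after the step and `S` the initial covariance. -/
lemma trace_descent {A S Y D : Matrix ι ι ℝ} {B : Matrix ι κ ℝ} {R : Matrix κ κ ℝ}
    {N W : Matrix κ ι ℝ} {η τ s lam ρ : ℝ} (hη : 0 ≤ η) (hlam : 0 < lam) (hs : 0 ≤ s) (hρ : 0 ≤ ρ)
    (hY : Y.PosSemidef) (hYA : A * Y + Y * Aᵀ + S = 0) (hτ : Y.trace ≤ τ)
    (hS : (S - lam • (1 : Matrix ι ι ℝ)).PosSemidef) (hR : R.PosSemidef)
    (hRρ : (ρ • (1 : Matrix κ κ ℝ) - R).PosSemidef) (hW : W = N * Y)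
    (hs1 : (s ^ 2 • (1 : Matrix ι ι ℝ) - (B * W) * (B * W)ᵀ).PosSemidef)
    (hs2 : (s ^ 2 • (1 : Matrix ι ι ℝ) - (B * W)ᵀ * (B * W)).PosSemidef)
    (hD : Dᵀ = D)
    (hDA : (A + (2 * η) • (B * W))ᵀ * D + D * (A + (2 * η) • (B * W))
      = (4 * η ^ 2) • (Wᵀ * R * W) - (2 * η) • (Wᵀ * N + Nᵀ * W))
    (hx : 4 * η * s * τ / lam < 1) :
    4 * η * (W * Wᵀ).trace * (1 - η * (τ * ρ) - 2 * (4 * η * s * τ / lam))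
      ≤ (1 - 4 * η * s * τ / lam) * (D * S).trace := by
  have hYt := hY.transpose_eq
  have hτ0 : 0 ≤ τ := hY.trace_nonneg.trans hτ
  have hWt : Wᵀ = Y * Nᵀ := by rw [hW, transpose_mul, hYt]
  generalize B * W = C at hs1 hs2 hDA
  set g := (W * Wᵀ).trace with hg
  have hg0 : 0 ≤ g := (posSemidef_mul_transpose W).trace_nonneg
  have hDYD : (D * Y * D).PosSemidef := by simpa [hD] using posSemidef_conj hY D
  -- `p` is the `Y`-weighted size of `D`, the only measure of the unknown value difference that
  -- enters the estimates.
  set p := Real.sqrt (D * Y * D).trace with hp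
  have hp2 : (D * Y * Dᵀ).trace = p ^ 2 := by rw [hD, hp, Real.sq_sqrt hDYD.trace_nonneg]
  have hp0 : 0 ≤ p := Real.sqrt_nonneg _
  set σ := Real.sqrt τ with hσ
  have hσ2 : σ ^ 2 = τ := Real.sq_sqrt hτ0
  have hσ0 : 0 ≤ σ := Real.sqrt_nonneg _
  have hYτ := posSemidef_smul_one_sub_of_trace_le hY hτ
  have hYYτ := posSemidef_sq_le hY hτ
  -- the Lyapunov equation for `D` relative to `A`
  have hDA' : Aᵀ * D + D * A = (4 * η ^ 2) • (Wᵀ * R * W) - (2 * η) • (Wᵀ * N + Nᵀ * W)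
      - (2 * η) • (Cᵀ * D + D * C) := by
    rw [← hDA]
    simp only [transpose_add, transpose_smul, Matrix.add_mul, Matrix.mul_add, Matrix.smul_mul,
      Matrix.mul_smul, smul_add]
    abel
  have t1 : (Y * (Wᵀ * N)).trace = g := by
    rw [← Matrix.mul_assoc, trace_mul_comm, ← Matrix.mul_assoc, ← hW]
  have t2 : (Y * (Nᵀ * W)).trace = g := by
    rw [← Matrix.mul_assoc, ← hWt, trace_mul_comm]
  have t3 : (Y * (Wᵀ * R * W)).trace = ((W * Y * Wᵀ) * R).trace := by
    rw [Matrix.mul_assoc Wᵀ, ← Matrix.mul_assoc Y, trace_mul_comm, Matrix.mul_assoc R,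
      trace_mul_comm R]
    simp only [Matrix.mul_assoc]
  have t4 : (Y * (D * C)).trace = (C * Y * D).trace := by
    rw [← Matrix.mul_assoc, trace_mul_comm, ← Matrix.mul_assoc]
  have t5 : (Y * (Cᵀ * D)).trace = (C * Y * D).trace := by
    rw [← t4, ← trace_transpose, transpose_mul, transpose_mul, transpose_transpose, hD, hYt,
      trace_mul_comm]
  -- Pairing with `Y`: a gain `4ηg`, a curvature loss in `R`, and a cross term still involving `D`.
  have e1 : (D * S).trace = 4 * η * g - 4 * η ^ 2 * ((W * Y * Wᵀ) * R).trace
      + 4 * η * (C * Y * D).trace := by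
    rw [trace_lyapunov_dual hYA, hDA']
    simp only [Matrix.mul_sub, Matrix.mul_add, Matrix.mul_smul, trace_sub, trace_add, trace_smul,
      smul_eq_mul, t1, t2, t3, t4, t5]
    ring
  have u1 : (Y * (D * Y * (Wᵀ * N))).trace = (D * Y * (Wᵀ * W)).trace := by
    rw [trace_mul_comm]; simp only [Matrix.mul_assoc, ← hW]
  have u2 : (Y * (D * Y * (Nᵀ * W))).trace = (D * Y * (Wᵀ * W)).trace := by
    rw [← trace_transpose (D * Y * (Wᵀ * W))]
    simp only [transpose_mul, transpose_transpose, hD, hYt]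
    rw [trace_mul_comm (Wᵀ * W), Matrix.mul_assoc D Y, ← Matrix.mul_assoc Y Nᵀ, ← hWt,
      ← Matrix.mul_assoc]
  have u3 : (Y * (D * Y * (Wᵀ * R * W))).trace = (D * Y * (Wᵀ * R * W * Y)).trace := by
    rw [trace_mul_comm]; simp only [Matrix.mul_assoc]
  have u4 : (Y * (D * Y * (D * C))).trace = (D * Y * (D * C * Y)).trace := by
    rw [trace_mul_comm]; simp only [Matrix.mul_assoc]
  have u5 : (Y * (D * Y * (Cᵀ * D))).trace = (D * Y * (D * C * Y)).trace := by
    rw [← u4, ← trace_transpose]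
    simp only [transpose_mul, transpose_transpose, hD, hYt]
    rw [trace_mul_comm, trace_mul_comm Y]
    simp only [Matrix.mul_assoc]
    rw [trace_mul_comm]
    simp only [Matrix.mul_assoc]
    rw [trace_mul_comm C]
    simp only [Matrix.mul_assoc]
  -- Pairing with `D Y D` gives an a priori bound: the left side dominates `lam * p ^ 2`, while the
  -- right side is linear in `p` apart from one quadratic term.
  have e2 : ((D * Y * D) * S).trace = 4 * η * (D * Y * (Wᵀ * W)).trace
      - 4 * η ^ 2 * (D * Y * (Wᵀ * R * W * Y)).trace + 4 * η * (D * Y * (D * C * Y)).trace := by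
    rw [trace_lyapunov_dual hYA]
    have h1 : (Y * (Aᵀ * (D * Y * D) + D * Y * D * A)).trace
        = (Y * (D * Y * (Aᵀ * D + D * A))).trace := by
      simp only [Matrix.mul_add, trace_add]
      congr 1
      · have hl : (Y * (Aᵀ * (D * Y * D))).trace = (Aᵀ * (D * Y * D * Y)).trace := by
          rw [trace_mul_comm]; simp only [Matrix.mul_assoc]
        have hr : (Y * (D * Y * (Aᵀ * D))).trace = (Aᵀ * (D * Y * D * Y)).trace := by
          rw [← Matrix.mul_assoc, trace_mul_comm]; simp only [Matrix.mul_assoc]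
        rw [hl, hr]
      · simp only [Matrix.mul_assoc]
    rw [h1, hDA']
    simp only [Matrix.mul_sub, Matrix.mul_add, Matrix.mul_smul, trace_sub, trace_add, trace_smul,
      smul_eq_mul, u1, u2, u3, u4, u5]
    ring
  -- bounds on the individual terms
  have b1 : |(D * Y * (Wᵀ * W)).trace| ≤ p * (σ * g) := by
    have hG := posSemidef_transpose_mul W
    have hGt : (Wᵀ * W).trace = g := trace_mul_comm _ _
    rw [← hG.transpose_eq]
    refine trace_cauchySchwarz_abs hY D (Wᵀ * W) hp0 (by positivity) hp2.le ?_
    rw [trace_mul_comm, ← Matrix.mul_assoc, hG.transpose_eq]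
    have hGG : ((Wᵀ * W) * (Wᵀ * W)).PosSemidef := by
      simpa [hG.transpose_eq] using posSemidef_mul_transpose (Wᵀ * W)
    calc _ ≤ τ * ((Wᵀ * W) * (Wᵀ * W)).trace := trace_mul_le hGG hYτ
      _ ≤ τ * g ^ 2 := by rw [← hGt]; exact mul_le_mul_of_nonneg_left (trace_sq_le hG) hτ0
      _ = (σ * g) ^ 2 := by rw [mul_pow, hσ2]
  have b2 : |(D * Y * (Wᵀ * R * W * Y)).trace| ≤ p * (σ * (τ * ρ) * g) := by
    have hG : (Wᵀ * R * W).PosSemidef := by simpa using posSemidef_conj hR Wᵀ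
    have hGt : (Wᵀ * R * W).trace ≤ ρ * g := by
      rw [trace_mul_comm, ← Matrix.mul_assoc]
      exact trace_mul_le (posSemidef_mul_transpose W) hRρ
    generalize Wᵀ * R * W = G at hG hGt
    have hQ : G * Y = (Y * G)ᵀ := by rw [transpose_mul, hYt, hG.transpose_eq]
    rw [hQ]
    refine trace_cauchySchwarz_abs hY D (Y * G) hp0 (by positivity) hp2.le ?_
    have hGYG : (G * Y * G).PosSemidef := by simpa [hG.transpose_eq] using posSemidef_conj hY G
    have hGG : (G * G).PosSemidef := by
      simpa [hG.transpose_eq] using posSemidef_mul_transpose G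
    have h1 : (Y * G * Y * (Y * G)ᵀ).trace = ((G * Y * G) * (Y * Y)).trace := by
      rw [← hQ]; simp only [Matrix.mul_assoc]; rw [trace_mul_comm]; simp only [Matrix.mul_assoc]
    calc _ = _ := h1
      _ ≤ τ ^ 2 * (G * Y * G).trace := trace_mul_le hGYG hYYτ
      _ = τ ^ 2 * ((G * G) * Y).trace := by
        rw [trace_mul_comm, ← Matrix.mul_assoc]
      _ ≤ τ ^ 2 * (τ * (ρ * g) ^ 2) := by
        refine mul_le_mul_of_nonneg_left ?_ (sq_nonneg τ)
        refine (trace_mul_le hGG hYτ).trans (mul_le_mul_of_nonneg_left ?_ hτ0)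
        exact (trace_sq_le hG).trans (pow_le_pow_left₀ hG.trace_nonneg hGt 2)
      _ = (σ * (τ * ρ) * g) ^ 2 := by rw [← hσ2]; ring
  have b3 : |(D * Y * (D * C * Y)).trace| ≤ p * (τ * s * p) := by
    have hQ : D * C * Y = (Y * Cᵀ * D)ᵀ := by
      simp only [transpose_mul, transpose_transpose, hYt, hD, Matrix.mul_assoc]
    rw [hQ]
    refine trace_cauchySchwarz_abs hY D (Y * Cᵀ * D) hp0 (by positivity) hp2.le ?_
    have h1 : (Y * Cᵀ * D * Y * (Y * Cᵀ * D)ᵀ).trace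
        = ((D * Y * D) * (C * (Y * Y) * Cᵀ)).trace := by
      rw [← hQ]; simp only [Matrix.mul_assoc]
      rw [← Matrix.mul_assoc Y Cᵀ, trace_mul_comm]; simp only [Matrix.mul_assoc]
    calc _ = _ := h1
      _ ≤ (τ ^ 2 * s ^ 2) * (D * Y * D).trace :=
        trace_mul_le hDYD (posSemidef_smul_one_sub_conj (sq_nonneg τ) hYYτ hs1)
      _ = (τ ^ 2 * s ^ 2) * (D * Y * Dᵀ).trace := by rw [hD]
      _ = (τ * s * p) ^ 2 := by rw [hp2]; ring
  have b4 : |(C * Y * D).trace| ≤ (s * σ) * p := by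
    rw [← hD]
    refine trace_cauchySchwarz_abs hY C D (by positivity) hp0 ?_ hp2.le
    rw [trace_mul_comm, ← Matrix.mul_assoc, trace_mul_comm]
    calc _ ≤ s ^ 2 * Y.trace := trace_mul_le hY hs2
      _ ≤ (s * σ) ^ 2 := by rw [mul_pow, hσ2]; gcongr
  have b5 : ((W * Y * Wᵀ) * R).trace ≤ ρ * (τ * g) := by
    refine (trace_mul_le (posSemidef_conj hY W) hRρ).trans (mul_le_mul_of_nonneg_left ?_ hρ)
    rw [trace_mul_comm, ← Matrix.mul_assoc]
    refine (trace_mul_le (posSemidef_transpose_mul W) hYτ).trans_eq ?_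
    rw [trace_mul_comm]
  have b6 : lam * p ^ 2 ≤ ((D * Y * D) * S).trace := by
    have := le_trace_mul hDYD hS
    rwa [← hp2, hD]
  clear_value p σ g
  set x := 4 * η * s * τ / lam with hxdef
  have hxl : x * lam = 4 * η * s * τ := by rw [hxdef]; field_simp
  have hx0 : 0 ≤ x := by positivity
  clear_value x
  -- The quadratic term is at most `x * lam * p ^ 2`, so it is absorbed on the left and one factor
  -- `p` cancels.
  have c1 : lam * (1 - x) * p ≤ 4 * η * σ * g * (1 + η * (τ * ρ)) := by
    rcases hp0.eq_or_lt with h | h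
    · rw [← h, mul_zero]; positivity
    refine le_of_mul_le_mul_right ?_ h
    have h1 := mul_le_mul_of_nonneg_left (abs_le.1 b1).2 (by positivity : 0 ≤ 4 * η)
    have h2 := mul_le_mul_of_nonneg_left (abs_le.1 b2).1 (by positivity : 0 ≤ 4 * η ^ 2)
    have h3 := mul_le_mul_of_nonneg_left (abs_le.1 b3).2 (by positivity : 0 ≤ 4 * η)
    have h4 : x * lam * p ^ 2 = 4 * η * s * τ * p ^ 2 := by rw [hxl]
    linear_combination b6 + e2 + h1 + h2 + h3 - h4
  have c2 : (1 - x) * (s * σ * p) ≤ x * g * (1 + η * (τ * ρ)) := by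
    refine le_of_mul_le_mul_left ?_ hlam
    have h1 := mul_le_mul_of_nonneg_left c1 (by positivity : 0 ≤ s * σ)
    have h2 : lam * (x * g * (1 + η * (τ * ρ))) = 4 * η * s * σ ^ 2 * g * (1 + η * (τ * ρ)) := by
      rw [hσ2]; linear_combination g * (1 + η * (τ * ρ)) * hxl
    rw [h2]
    linear_combination h1
  have h1 := mul_le_mul_of_nonneg_left b5 (by positivity : 0 ≤ 4 * η ^ 2)
  have h2 := mul_le_mul_of_nonneg_left (abs_le.1 b4).1 (by positivity : 0 ≤ 4 * η)
  have h3 : 4 * η * g * (1 - η * (τ * ρ)) - 4 * η * (s * σ * p) ≤ (D * S).trace := by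
    rw [e1]; linear_combination h1 + h2
  have h4 := mul_le_mul_of_nonneg_left h3 (by linarith : 0 ≤ 1 - x)
  have h5 := mul_le_mul_of_nonneg_left c2 (by positivity : 0 ≤ 4 * η)
  linear_combination h4 + h5

end Descent

/-! ### Value matrices and exact cost differences -/

namespace Problem

open Matrix

variable {n m : ℕ} {P : Problem n m}

lemma Sig_posDef (hx₀ : Submodule.span ℝ (Set.range P.x₀) = ⊤) : P.Sig.PosDef := by
  have hquad : ∀ x, x ⬝ᵥ P.Sig *ᵥ x = ∑ j, (P.x₀ j ⬝ᵥ x) ^ 2 := fun x ↦ by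
    rw [Sig, sum_mulVec, dotProduct_sum]
    refine Finset.sum_congr rfl fun j _ ↦ ?_
    rw [vecMulVec_mulVec, sq]
    simp [dotProduct_comm x]
  refine posDef_iff_real.2 ⟨?_, fun x hx ↦ ?_⟩
  · simp [Sig, transpose_sum, transpose_vecMulVec]
  · rw [hquad]
    refine lt_of_le_of_ne (Finset.sum_nonneg fun j _ ↦ sq_nonneg _) fun h0 ↦ hx ?_
    have h1 : ∀ j, P.x₀ j ⬝ᵥ x = 0 := fun j ↦ by
      have := (Finset.sum_eq_zero_iff_of_nonneg fun j _ ↦ sq_nonneg (P.x₀ j ⬝ᵥ x)).1 h0.symm j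
        (Finset.mem_univ j)
      exact pow_eq_zero_iff two_ne_zero |>.1 this
    have h2 : ∀ y ∈ Submodule.span ℝ (Set.range P.x₀), y ⬝ᵥ x = 0 := fun y hy ↦ by
      induction hy using Submodule.span_induction with
      | mem y hy => obtain ⟨j, rfl⟩ := hy; exact h1 j
      | zero => simp
      | add y z _ _ hy hz => rw [add_dotProduct, hy, hz, add_zero]
      | smul c y _ hy => rw [smul_dotProduct, hy, smul_zero]
    exact dotProduct_self_eq_zero.1 (h2 x (hx₀ ▸ Submodule.mem_top))

variable {K L : Matrix (Fin m) (Fin n) ℝ}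

lemma X_eq (hK : K ∈ P.stabilizing) :
    (P.closedLoop K)ᵀ * P.X K + P.X K * P.closedLoop K + (Kᵀ * P.R * K + P.Q) = 0 := by
  have h : ∃ X, (P.closedLoop K)ᵀ * X + X * P.closedLoop K + (Kᵀ * P.R * K + P.Q) = 0 := by
    simpa using (IsHurwitz.transpose hK).exists_lyapunov (Kᵀ * P.R * K + P.Q)
  rw [X, lyapunovSolution, dif_pos h]
  exact h.choose_spec

lemma Y_eq (hK : K ∈ P.stabilizing) :
    P.closedLoop K * P.Y K + P.Y K * (P.closedLoop K)ᵀ + P.Sig = 0 := by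
  have h : ∃ Y, (P.closedLoop K)ᵀᵀ * Y + Y * (P.closedLoop K)ᵀ + P.Sig = 0 := by
    simpa using IsHurwitz.exists_lyapunov hK P.Sig
  rw [Y, lyapunovSolution, dif_pos h]
  simpa using h.choose_spec

lemma X_unique (hK : K ∈ P.stabilizing) {Z : Matrix (Fin n) (Fin n) ℝ}
    (hZ : (P.closedLoop K)ᵀ * Z + Z * P.closedLoop K + (Kᵀ * P.R * K + P.Q) = 0) : P.X K = Z :=
  (IsHurwitz.transpose hK).lyapunov_unique (by simpa using X_eq hK) (by simpa using hZ)

lemma weight_posDef (hQ : P.Q.PosDef) (hR : P.R.PosDef) (K : Matrix (Fin m) (Fin n) ℝ) :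
    (Kᵀ * P.R * K + P.Q).PosDef := by
  refine Matrix.PosDef.posSemidef_add ?_ hQ
  simpa using posSemidef_conj hR.posSemidef Kᵀ

lemma X_posDef (hQ : P.Q.PosDef) (hR : P.R.PosDef) (hK : K ∈ P.stabilizing) : (P.X K).PosDef :=
  (IsHurwitz.transpose hK).lyapunov_posDef (weight_posDef hQ hR K) (by simpa using X_eq hK)

lemma Y_posDef (hS : P.Sig.PosDef) (hK : K ∈ P.stabilizing) : (P.Y K).PosDef :=
  IsHurwitz.lyapunov_posDef hK hS (Y_eq hK)

/-- Subtract the two value equations. Since the closed loops differ by `B (L - K)`, the terms linear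
in `L - K` assemble into `N K`. -/
lemma X_sub_lyapunov (hQ : P.Q.PosDef) (hR : P.R.PosDef) (hK : K ∈ P.stabilizing)
    (hL : L ∈ P.stabilizing) :
    (P.closedLoop L)ᵀ * (P.X L - P.X K) + (P.X L - P.X K) * P.closedLoop L
      = -((L - K)ᵀ * P.N K + (P.N K)ᵀ * (L - K) + (L - K)ᵀ * P.R * (L - K)) := by
  have h1 := X_eq hK
  have h2 := X_eq hL
  have hX := (X_posDef hQ hR hK).transpose_eq
  obtain ⟨E, rfl⟩ : ∃ E, L = K + E := ⟨L - K, by abel⟩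
  have hc : P.closedLoop (K + E) = P.closedLoop K - P.B * E := by
    simp only [closedLoop, Matrix.mul_add]; abel
  rw [hc] at h2 ⊢
  rw [add_sub_cancel_left, N]
  simp only [transpose_add, transpose_sub, transpose_mul, transpose_transpose, hX,
    hR.transpose_eq, Matrix.mul_add, Matrix.add_mul, Matrix.mul_sub, Matrix.sub_mul,
    Matrix.mul_assoc] at h1 h2 ⊢
  rw [← sub_eq_zero, ← sub_eq_zero.2 (h2.trans h1.symm)]
  abel

/-- Exact because the weight `Y` is taken at the new gain `L`. Different choices of the pair yield
the gradient, quadratic growth and gradient domination. -/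
lemma cost_sub (hQ : P.Q.PosDef) (hR : P.R.PosDef) (hK : K ∈ P.stabilizing)
    (hL : L ∈ P.stabilizing) :
    P.cost L - P.cost K = (P.Y L * ((L - K)ᵀ * P.N K + (P.N K)ᵀ * (L - K))).trace
      + (P.Y L * ((L - K)ᵀ * P.R * (L - K))).trace := by
  rw [cost, cost, ← trace_sub, ← Matrix.sub_mul, trace_lyapunov_dual (Y_eq hL),
    X_sub_lyapunov hQ hR hK hL, Matrix.mul_neg, trace_neg, neg_neg, ← trace_add, ← Matrix.mul_add]

lemma cost_eq (hK : K ∈ P.stabilizing) :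
    P.cost K = (P.Y K * (Kᵀ * P.R * K + P.Q)).trace := by
  rw [cost, trace_lyapunov_dual (Y_eq hK), eq_neg_of_add_eq_zero_left (X_eq hK), Matrix.mul_neg,
    trace_neg, neg_neg]

lemma lambdaMin_mul_trace_Y_le (hQ : P.Q.PosDef) (hR : P.R.PosDef) (hS : P.Sig.PosDef)
    (hK : K ∈ P.stabilizing) : lambdaMin P.Q * (P.Y K).trace ≤ P.cost K := by
  have hY := (Y_posDef hS hK).posSemidef
  have h1 : 0 ≤ (P.Y K * (Kᵀ * P.R * K)).trace :=
    trace_mul_nonneg hY (by simpa using posSemidef_conj hR.posSemidef Kᵀ)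
  have h2 := le_trace_mul hY (lambdaMin_posSemidef hQ.transpose_eq)
  rw [cost_eq hK, Matrix.mul_add, trace_add]
  linarith

lemma lambdaMin_mul_trace_X_le (hQ : P.Q.PosDef) (hR : P.R.PosDef) (hS : P.Sig.PosDef)
    (hK : K ∈ P.stabilizing) : lambdaMin P.Sig * (P.X K).trace ≤ P.cost K :=
  le_trace_mul (X_posDef hQ hR hK).posSemidef (lambdaMin_posSemidef hS.transpose_eq)

lemma cost_pos (hn : 0 < n) (hQ : P.Q.PosDef) (hR : P.R.PosDef) (hS : P.Sig.PosDef)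
    (hK : K ∈ P.stabilizing) : 0 < P.cost K := by
  have : Nonempty (Fin n) := ⟨⟨0, hn⟩⟩
  exact (mul_pos (lambdaMin_pos hn hQ) (Y_posDef hS hK).trace_pos).trans_le
    (lambdaMin_mul_trace_Y_le hQ hR hS hK)

/-! ### Perturbation of the gain and the gradient formula -/

/-- A perturbation of a stabilizing gain which changes the Lyapunov equation by less than its
constant term is again stabilizing. -/
lemma add_mem_stabilizing (hS : P.Sig.PosDef) (hK : K ∈ P.stabilizing)
    {E : Matrix (Fin m) (Fin n) ℝ} {δ : ℝ} (hδ : δ < 1)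
    (h : (δ • P.Sig + (P.B * E * P.Y K + (P.B * E * P.Y K)ᵀ)).PosSemidef) :
    K + E ∈ P.stabilizing := by
  have hY := Y_posDef hS hK
  refine isHurwitz_of_posDef hY ?_
  have h1 : ((1 - δ) • P.Sig).PosDef := hS.smul (by linarith)
  convert h1.add_posSemidef h using 1
  rw [← sub_eq_zero, ← neg_eq_zero, ← Y_eq hK]
  simp only [closedLoop, transpose_mul, transpose_sub, Matrix.mul_add, Matrix.add_mul, Matrix.sub_mul,
    Matrix.mul_sub, hY.transpose_eq, sub_smul, one_smul, transpose_add, Matrix.mul_assoc]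
  abel

/-- The change in `Y` solves the Lyapunov equation of the new closed loop, whose constant term is
compared with `δ • Σ`. With its mirror image below it sandwiches that change between multiples of
the new `Y`. -/
lemma Y_add_sub_posSemidef (hK : K ∈ P.stabilizing)
    {E : Matrix (Fin m) (Fin n) ℝ} (hY : (P.Y K)ᵀ = P.Y K) (hL : K + E ∈ P.stabilizing) {δ : ℝ}
    (h : (δ • P.Sig + (P.B * E * P.Y K + (P.B * E * P.Y K)ᵀ)).PosSemidef) :
    (δ • P.Y (K + E) - (P.Y (K + E) - P.Y K)).PosSemidef := by
  refine IsHurwitz.lyapunov_posSemidef hL h ?_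
  have h1 := Y_eq hK
  have h2 := Y_eq hL
  have hc : P.closedLoop K = P.closedLoop (K + E) + P.B * E := by
    simp only [closedLoop, Matrix.mul_add]; abel
  rw [hc] at h1
  have h3 : (δ - 1) • (P.closedLoop (K + E) * P.Y (K + E)
      + P.Y (K + E) * (P.closedLoop (K + E))ᵀ + P.Sig) = 0 := by rw [h2, smul_zero]
  have h4 := congrArg₂ (· + ·) h1 h3
  simp only [add_zero] at h4
  rw [← h4]
  simp only [transpose_mul, transpose_add, Matrix.mul_add, Matrix.add_mul, Matrix.sub_mul,
    Matrix.mul_sub, hY, sub_smul, one_smul, smul_add, Matrix.smul_mul, Matrix.mul_smul,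
    Matrix.mul_assoc]
  abel

lemma Y_add_add_posSemidef (hK : K ∈ P.stabilizing)
    {E : Matrix (Fin m) (Fin n) ℝ} (hY : (P.Y K)ᵀ = P.Y K) (hL : K + E ∈ P.stabilizing) {δ : ℝ}
    (h : (δ • P.Sig - (P.B * E * P.Y K + (P.B * E * P.Y K)ᵀ)).PosSemidef) :
    (δ • P.Y (K + E) + (P.Y (K + E) - P.Y K)).PosSemidef := by
  refine IsHurwitz.lyapunov_posSemidef hL h ?_
  have h1 := Y_eq hK
  have h2 := Y_eq hL
  have hc : P.closedLoop K = P.closedLoop (K + E) + P.B * E := by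
    simp only [closedLoop, Matrix.mul_add]; abel
  rw [hc] at h1
  have h3 : (δ + 1) • (P.closedLoop (K + E) * P.Y (K + E)
      + P.Y (K + E) * (P.closedLoop (K + E))ᵀ + P.Sig) = 0 := by rw [h2, smul_zero]
  have h4 := congrArg₂ (· - ·) h3 h1
  simp only [sub_zero] at h4
  rw [← h4]
  simp only [transpose_mul, transpose_add, Matrix.mul_add, Matrix.add_mul, Matrix.sub_mul,
    Matrix.mul_sub, hY, add_smul, one_smul, smul_add, Matrix.smul_mul, Matrix.mul_smul,
    Matrix.mul_assoc]
  abel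

lemma exists_posSemidef_bound {k : ℕ} {M : Matrix (Fin k) (Fin k) ℝ} (hM : Mᵀ = M) :
    ∃ c : ℝ, 0 ≤ c ∧ (c • (1 : Matrix (Fin k) (Fin k) ℝ) - M).PosSemidef ∧
      (c • (1 : Matrix (Fin k) (Fin k) ℝ) + M).PosSemidef := by
  have h1 := lambdaMax_posSemidef hM
  have h2 := lambdaMax_posSemidef (M := -M) (by simp [hM])
  have aux : ∀ a b : ℝ, a ≤ b → ∀ N : Matrix (Fin k) (Fin k) ℝ,
      (a • (1 : Matrix (Fin k) (Fin k) ℝ) - N).PosSemidef →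
      (b • (1 : Matrix (Fin k) (Fin k) ℝ) - N).PosSemidef := fun a b hab N h ↦ by
    have := h.add ((PosSemidef.one (n := Fin k) (R := ℝ)).smul (sub_nonneg.2 hab))
    convert this using 1
    rw [sub_smul]; abel
  refine ⟨max 0 (max (lambdaMax M) (lambdaMax (-M))), le_max_left _ _, aux _ _ ?_ _ h1, ?_⟩
  · exact (le_max_left _ _).trans (le_max_right _ _)
  · have := aux _ _ ((le_max_right _ _).trans (le_max_right _ _) :
      lambdaMax (-M) ≤ max 0 (max (lambdaMax M) (lambdaMax (-M)))) _ h2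
    rwa [sub_neg_eq_add] at this

/-- Add nonnegative traces of products such as `(Z - V)(g + H)` and `(Z + V)(g - H)`: the mixed
terms cancel. -/
lemma abs_trace_mul_le {k : ℕ} {V Z H : Matrix (Fin k) (Fin k) ℝ} {g : ℝ}
    (h1 : (Z - V).PosSemidef) (h2 : (Z + V).PosSemidef)
    (h3 : (g • (1 : Matrix (Fin k) (Fin k) ℝ) - H).PosSemidef)
    (h4 : (g • (1 : Matrix (Fin k) (Fin k) ℝ) + H).PosSemidef) :
    |(V * H).trace| ≤ g * Z.trace := by
  have a1 := trace_mul_nonneg h1 h3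
  have a2 := trace_mul_nonneg h1 h4
  have a3 := trace_mul_nonneg h2 h3
  have a4 := trace_mul_nonneg h2 h4
  simp only [Matrix.mul_sub, Matrix.mul_add, Matrix.sub_mul, Matrix.add_mul, Matrix.mul_smul,
    Matrix.mul_one, trace_add, trace_sub, trace_smul, smul_eq_mul] at a1 a2 a3 a4
  exact abs_le.2 ⟨by linarith, by linarith⟩

/-- Second-order expansion of the cost along a line. -/
lemma exists_cost_expansion (hn : 0 < n) (hQ : P.Q.PosDef) (hR : P.R.PosDef) (hS : P.Sig.PosDef)
    (hK : K ∈ P.stabilizing) (E : Matrix (Fin m) (Fin n) ℝ) :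
    ∃ C ε : ℝ, 0 < ε ∧ ∀ t : ℝ, |t| ≤ ε →
      |P.cost (K + t • E) - P.cost K - t * (P.Y K * (Eᵀ * P.N K + (P.N K)ᵀ * E)).trace|
        ≤ C * t ^ 2 := by
  have hY := Y_posDef hS hK
  obtain ⟨c, hc0, hc1, hc2⟩ := exists_posSemidef_bound
    (M := P.B * E * P.Y K + (P.B * E * P.Y K)ᵀ) (by simp [add_comm])
  obtain ⟨g, hg0, hg1, hg2⟩ := exists_posSemidef_bound
    (M := Eᵀ * P.N K + (P.N K)ᵀ * E) (by simp [add_comm])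
  have hG : (Eᵀ * P.R * E).PosSemidef := by simpa using posSemidef_conj hR.posSemidef Eᵀ
  obtain ⟨r, hr0, hr1, -⟩ := exists_posSemidef_bound hG.transpose_eq
  set M := P.B * E * P.Y K + (P.B * E * P.Y K)ᵀ with hM
  set H := Eᵀ * P.N K + (P.N K)ᵀ * E with hH
  clear_value M H
  have hlam := lambdaMin_pos hn hS
  set lam := lambdaMin P.Sig with hlamdef
  have hSig : ∀ δ : ℝ, 0 ≤ δ → ∀ N : Matrix (Fin n) (Fin n) ℝ,
      ((δ * lam) • (1 : Matrix (Fin n) (Fin n) ℝ) + N).PosSemidef →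
      (δ • P.Sig + N).PosSemidef := fun δ hδ N hN ↦ by
    have := ((lambdaMin_posSemidef hS.transpose_eq).smul hδ).add hN
    convert this using 1
    rw [smul_sub, smul_smul]; abel
  -- This `ε` forces `δ ≤ 1/2`, so the trace of `Y` at most doubles; in `C`, `c / lam * g` comes
  -- from the variation of `Y` and `r` from the quadratic `R` term.
  refine ⟨2 * (P.Y K).trace * (c / lam * g + r), lam / (2 * (c + 1)), by positivity,
    fun t ht ↦ ?_⟩
  set δ := |t| * (c / lam) with hδ
  have hδ0 : 0 ≤ δ := by positivity
  have hδ1 : δ ≤ 1 / 2 := by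
    calc δ ≤ lam / (2 * (c + 1)) * (c / lam) := mul_le_mul_of_nonneg_right ht (by positivity)
      _ = c / (2 * (c + 1)) := by field_simp
      _ ≤ 1 / 2 := by rw [div_le_div_iff₀ (by positivity) (by norm_num)]; linarith
  have hδl : δ * lam = |t| * c := by rw [hδ]; field_simp
  have htM : P.B * (t • E) * P.Y K + (P.B * (t • E) * P.Y K)ᵀ = t • M := by
    simp [hM, Matrix.mul_smul, smul_add]
  have hMp : (δ • P.Sig + t • M).PosSemidef := by
    refine hSig δ hδ0 _ ?_
    rw [hδl]
    rcases abs_cases t with ⟨h, h'⟩ | ⟨h, h'⟩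
    · rw [h, mul_smul, ← smul_add]; exact hc2.smul h'
    · have := hc1.smul (by linarith : 0 ≤ -t)
      convert this using 1
      rw [h, smul_sub, smul_smul]; simp
  have hMm : (δ • P.Sig - t • M).PosSemidef := by
    rw [sub_eq_add_neg]
    refine hSig δ hδ0 _ ?_
    rw [hδl, ← sub_eq_add_neg]
    rcases abs_cases t with ⟨h, h'⟩ | ⟨h, h'⟩
    · rw [h, mul_smul, ← smul_sub]; exact hc1.smul h'
    · have := hc2.smul (by linarith : 0 ≤ -t)
      convert this using 1
      rw [h, smul_add, smul_smul]; simp [sub_eq_add_neg]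
  rw [← htM] at hMp hMm
  have hL := add_mem_stabilizing hS hK (by linarith) hMp
  have hV1 := Y_add_sub_posSemidef hK hY.transpose_eq hL hMp
  have hV2 := Y_add_add_posSemidef hK hY.transpose_eq hL hMm
  have hYL := Y_posDef hS hL
  have htr : (P.Y (K + t • E)).trace ≤ 2 * (P.Y K).trace := by
    have h1 := hV1.trace_nonneg
    have h2 := hYL.posSemidef.trace_nonneg
    simp only [trace_sub, trace_smul, smul_eq_mul] at h1
    nlinarith
  have hb1 := abs_trace_mul_le hV1 hV2 hg1 hg2
  have hb2 := trace_mul_le hYL.posSemidef hr1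
  have hb3 := trace_mul_nonneg hYL.posSemidef hG
  have hdiff := cost_sub hQ hR hK hL
  have hN1 : (t • E)ᵀ * P.N K + (P.N K)ᵀ * (t • E) = t • H := by
    simp [hH, smul_add]
  have hN2 : (t • E)ᵀ * P.R * (t • E) = t ^ 2 • (Eᵀ * P.R * E) := by
    simp [smul_smul, sq]
  rw [add_sub_cancel_left, hN1, hN2] at hdiff
  rw [hdiff]
  simp only [Matrix.mul_smul, trace_smul, smul_eq_mul, Matrix.sub_mul, trace_sub] at hb1 ⊢
  have hfin : |t * ((P.Y (K + t • E) * H).trace - (P.Y K * H).trace)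
      + t ^ 2 * (P.Y (K + t • E) * (Eᵀ * P.R * E)).trace|
      ≤ |t| * (g * (δ * (P.Y (K + t • E)).trace)) + t ^ 2 * (r * (P.Y (K + t • E)).trace) := by
    refine (abs_add_le _ _).trans (add_le_add ?_ ?_)
    · rw [abs_mul]; exact mul_le_mul_of_nonneg_left hb1 (abs_nonneg t)
    · rw [abs_mul, abs_of_nonneg (sq_nonneg t), abs_of_nonneg hb3]
      exact mul_le_mul_of_nonneg_left hb2 (sq_nonneg t)
  have hlast : |t| * (g * (δ * (P.Y (K + t • E)).trace)) + t ^ 2 * (r * (P.Y (K + t • E)).trace)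
      = (c / lam * g + r) * t ^ 2 * (P.Y (K + t • E)).trace := by
    rw [hδ, ← sq_abs t]; ring
  rw [hlast] at hfin
  have hmono := mul_le_mul_of_nonneg_left htr
    (by positivity : 0 ≤ (c / lam * g + r) * t ^ 2)
  calc _ = _ := by congr 1; ring
    _ ≤ _ := hfin
    _ ≤ _ := hmono
    _ = _ := by ring

/-- The bound at `t = 0` already identifies `a` with `f 0`. -/
lemma hasDerivAt_of_quadratic_bound {f : ℝ → ℝ} {a f' C ε : ℝ} (hε : 0 < ε)
    (h : ∀ t : ℝ, |t| ≤ ε → |f t - a - t * f'| ≤ C * t ^ 2) : HasDerivAt f f' 0 := by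
  have h0 : f 0 = a := by
    have := h 0 (by simpa using hε.le)
    simp only [zero_mul, sub_zero, ne_eq, OfNat.ofNat_ne_zero, not_false_eq_true, zero_pow,
      mul_zero] at this
    exact sub_eq_zero.1 (abs_nonpos_iff.1 this)
  rw [hasDerivAt_iff_isLittleO]
  have hO : (fun t ↦ f t - f 0 - (t - 0) • f') =O[nhds 0] fun t : ℝ ↦ t ^ 2 := by
    refine Asymptotics.IsBigO.of_bound C ?_
    filter_upwards [Metric.closedBall_mem_nhds (0 : ℝ) hε] with t ht
    have := h t (by simpa using ht)
    simpa [h0, abs_of_nonneg (sq_nonneg t)] using this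
  refine hO.trans_isLittleO ?_
  simpa using Asymptotics.isLittleO_pow_id (𝕜 := ℝ) one_lt_two

/-- The gradient of the cost is `2 N(K) Y(K)`. -/
lemma gradCost_eq (hn : 0 < n) (hQ : P.Q.PosDef) (hR : P.R.PosDef) (hS : P.Sig.PosDef)
    (hK : K ∈ P.stabilizing) : P.gradCost K = (2 : ℝ) • (P.N K * P.Y K) := by
  ext i j
  obtain ⟨C, ε, hε, h⟩ := exists_cost_expansion hn hQ hR hS hK (single i j (1 : ℝ))
  rw [gradCost, of_apply, (hasDerivAt_of_quadratic_bound hε h).deriv]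
  have hY := (Y_posDef hS hK).transpose_eq
  have h1 : (P.Y K * ((single i j (1 : ℝ))ᵀ * P.N K)).trace = (P.N K * P.Y K) i j := by
    rw [trace_mul_comm, Matrix.mul_assoc, transpose_single]
    simp [trace_single_mul]
  have h2 : (P.Y K * ((P.N K)ᵀ * single i j (1 : ℝ))).trace = (P.N K * P.Y K) i j := by
    rw [← h1, ← trace_transpose, trace_mul_comm (P.Y K)]
    simp [hY]
  rw [Matrix.mul_add, trace_add, h1, h2]
  simp [two_mul]

/-! ### The step size and the gradient step -/

lemma posSemidef_two_smul_sub_symm {ι : Type*} [Fintype ι] [DecidableEq ι] {Z : Matrix ι ι ℝ}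
    {r : ℝ} (hr : 0 ≤ r) (h : (r ^ 2 • (1 : Matrix ι ι ℝ) - Z * Zᵀ).PosSemidef) :
    ((2 * r) • (1 : Matrix ι ι ℝ) - (Z + Zᵀ)).PosSemidef := by
  refine posSemidef_iff_real.2 ⟨by simp [add_comm], fun x ↦ ?_⟩
  have h1 := (posSemidef_iff_real.1 h).2 x
  have h2 : x ⬝ᵥ Zᵀ *ᵥ x = x ⬝ᵥ Z *ᵥ x := by
    rw [dotProduct_mulVec, vecMul_transpose, dotProduct_comm]
  have h3 : x ⬝ᵥ (Z * Zᵀ) *ᵥ x = (Zᵀ *ᵥ x) ⬝ᵥ (Zᵀ *ᵥ x) := by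
    rw [← mulVec_mulVec, dotProduct_mulVec, mulVec_transpose]
  have hcs : (x ⬝ᵥ Zᵀ *ᵥ x) ^ 2 ≤ (x ⬝ᵥ x) * ((Zᵀ *ᵥ x) ⬝ᵥ (Zᵀ *ᵥ x)) := by
    have := Finset.sum_mul_sq_le_sq_mul_sq Finset.univ x (Zᵀ *ᵥ x)
    simpa only [dotProduct, ← sq] using this
  have hx : 0 ≤ x ⬝ᵥ x := by
    simp only [dotProduct]; exact Finset.sum_nonneg fun i _ ↦ mul_self_nonneg _
  simp only [sub_mulVec, add_mulVec, smul_mulVec, one_mulVec, dotProduct_sub, dotProduct_add,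
    dotProduct_smul, smul_eq_mul, h2, h3] at h1 ⊢
  rw [h2] at hcs
  have h4 : (x ⬝ᵥ Z *ᵥ x) ^ 2 ≤ (r * (x ⬝ᵥ x)) ^ 2 := by nlinarith
  have h5 := abs_le_of_sq_le_sq' h4 (by positivity)
  linarith [h5.2]

lemma stepsize_spec {d : ℝ} (hd : 0 < d) :
    0 < Real.sqrt (1 / (3 * d) + 1 / 9) - 1 / 3 ∧
      2 * (Real.sqrt (1 / (3 * d) + 1 / 9) - 1 / 3) * d ≤ 1 := by
  have hpos : 0 < 1 / (3 * d) := by positivity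
  have h1 : 0 < Real.sqrt (1 / (3 * d) + 1 / 9) - 1 / 3 := by
    rw [sub_pos]
    exact Real.lt_sqrt_of_sq_lt (by linarith)
  have h2 : Real.sqrt (1 / (3 * d) + 1 / 9) ^ 2 = 1 / (3 * d) + 1 / 9 :=
    Real.sq_sqrt (by positivity)
  set η := Real.sqrt (1 / (3 * d) + 1 / 9) - 1 / 3 with hη
  have h3 : Real.sqrt (1 / (3 * d) + 1 / 9) = η + 1 / 3 := by rw [hη]; ring
  rw [h3] at h2
  have h4 : 3 * d * (1 / (3 * d)) = 1 := by field_simp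
  refine ⟨h1, ?_⟩
  -- The step size is the positive root of this quadratic; dropping the square term leaves the bound
  -- on `2ηd`.
  have h5 : 3 * d * η ^ 2 + 2 * η * d = 1 := by linear_combination 3 * d * h2 + h4
  have h6 : 0 ≤ 3 * d * η ^ 2 := by positivity
  linarith

lemma bConst_pos (hn : 0 < n) (hm : 0 < m) (hQ : P.Q.PosDef) (hR : P.R.PosDef)
    (hS : P.Sig.PosDef) (hK : K ∈ P.stabilizing) : 0 < P.bConst K := by
  have h1 := cost_pos hn hQ hR hS hK
  have h2 := lambdaMax_pos hm hR
  have h3 := lambdaMin_pos hn hQ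
  have h4 := lambdaMin_pos hn hS
  have h5 := spectralNorm_nonneg (P.B * P.N K * P.Y K)
  rw [bConst]
  positivity

/-- A gradient step stays in the stabilizing set and decreases the cost. -/
lemma gradient_step (hn : 0 < n) (hm : 0 < m) (hQ : P.Q.PosDef) (hR : P.R.PosDef)
    (hS : P.Sig.PosDef) (hK : K ∈ P.stabilizing) :
    K - P.stepsize K • P.gradCost K ∈ P.stabilizing ∧
      4 * P.stepsize K ^ 2 * (P.cost K / lambdaMin P.Q * lambdaMax P.R)
          * (P.N K * P.Y K * (P.N K * P.Y K)ᵀ).trace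
        ≤ P.cost K - P.cost (K - P.stepsize K • P.gradCost K) := by
  have hc := cost_pos hn hQ hR hS hK
  have hρ := lambdaMax_pos hm hR
  have hq := lambdaMin_pos hn hQ
  have hlam := lambdaMin_pos hn hS
  have hY := Y_posDef hS hK
  have hb := bConst_pos hn hm hQ hR hS hK
  have hbd : P.bConst K ≤ P.dConst K := le_max_left _ _
  obtain ⟨hη, hηd⟩ := stepsize_spec (hb.trans_le hbd)
  rw [← stepsize] at hη hηd
  set η := P.stepsize K with hηdef
  set W := P.N K * P.Y K with hW
  set s := spectralNorm (P.B * P.N K * P.Y K) with hs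
  have hs0 : 0 ≤ s := spectralNorm_nonneg _
  set τ := P.cost K / lambdaMin P.Q with hτ
  have hτ0 : 0 < τ := div_pos hc hq
  have hYτ : (P.Y K).trace ≤ τ := by
    rw [hτ, le_div_iff₀' hq]; exact lambdaMin_mul_trace_Y_le hQ hR hS hK
  -- The two summands of `b` are the two error sizes of `trace_descent`.
  have hbeq : η * P.bConst K = η * (τ * lambdaMax P.R) + 4 * η * s * τ / lambdaMin P.Sig := by
    rw [bConst, hτ, ← hs]; field_simp
  set ρ := lambdaMax P.R
  set lam := lambdaMin P.Sig
  set x := 4 * η * s * τ / lam with hx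
  have hx0 : 0 ≤ x := by positivity
  have ha0 : 0 < η * (τ * ρ) := by positivity
  have hsum : 2 * (η * (τ * ρ) + x) ≤ 1 := by
    rw [← hbeq]
    have := mul_le_mul_of_nonneg_left hbd hη.le
    linarith
  have hBW : P.B * W = P.B * P.N K * P.Y K := by rw [hW, Matrix.mul_assoc]
  have hs1 : (s ^ 2 • (1 : Matrix (Fin n) (Fin n) ℝ) - (P.B * W) * (P.B * W)ᵀ).PosSemidef := by
    rw [hBW]; exact spectralNorm_mul_transpose _
  have hs2 : (s ^ 2 • (1 : Matrix (Fin n) (Fin n) ℝ) - (P.B * W)ᵀ * (P.B * W)).PosSemidef := by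
    rw [hBW]; exact spectralNorm_transpose_mul _
  have hstep : K - η • P.gradCost K = K + -(2 * η) • W := by
    rw [gradCost_eq hn hQ hR hS hK, smul_smul, neg_smul, sub_eq_add_neg, mul_comm]
  rw [hstep]
  have hEY : P.B * (-(2 * η) • W) * P.Y K + (P.B * (-(2 * η) • W) * P.Y K)ᵀ
      = -((2 * η) • (P.B * W * P.Y K + (P.B * W * P.Y K)ᵀ)) := by
    simp [Matrix.mul_smul, smul_add, add_comm]
  -- The spectral norm of `B W Y` is at most `s τ`, so the perturbation is at most `4ηsτ = x
  -- λ_min(Σ)`, which `x • Σ` dominates.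
  have hpert : (x • P.Sig + (P.B * (-(2 * η) • W) * P.Y K
      + (P.B * (-(2 * η) • W) * P.Y K)ᵀ)).PosSemidef := by
    have h1 : ((s * τ) ^ 2 • (1 : Matrix (Fin n) (Fin n) ℝ)
        - (P.B * W * P.Y K) * (P.B * W * P.Y K)ᵀ).PosSemidef := by
      have := posSemidef_smul_one_sub_conj (sq_nonneg τ)
        (posSemidef_sq_le hY.posSemidef hYτ) hs1
      convert this using 2
      · rw [mul_pow, mul_comm]
      · rw [transpose_mul (P.B * W) (P.Y K), hY.transpose_eq]; simp only [Matrix.mul_assoc]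
    have h2 := (posSemidef_two_smul_sub_symm (by positivity) h1).smul
      (by positivity : 0 ≤ 2 * η)
    have h3 := ((lambdaMin_posSemidef hS.transpose_eq).smul hx0).add h2
    rw [hEY]
    convert h3 using 1
    have h4 : x * lam = 2 * η * (2 * (s * τ)) := by rw [hx]; field_simp; ring
    rw [smul_sub, smul_sub, smul_smul, smul_smul, h4]
    abel
  have hL := add_mem_stabilizing hS hK (by linarith) hpert
  refine ⟨hL, ?_⟩
  have hXK := (X_posDef hQ hR hK).transpose_eq
  have hXL := (X_posDef hQ hR hL).transpose_eq
  have hdiff := X_sub_lyapunov hQ hR hK hL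
  have hcl : P.closedLoop (K + -(2 * η) • W) = P.closedLoop K + (2 * η) • (P.B * W) := by
    simp only [closedLoop, Matrix.mul_add, neg_smul, Matrix.mul_neg, Matrix.mul_smul]; abel
  have hDA : (P.closedLoop K + (2 * η) • (P.B * W))ᵀ * (P.X K - P.X (K + -(2 * η) • W))
      + (P.X K - P.X (K + -(2 * η) • W)) * (P.closedLoop K + (2 * η) • (P.B * W))
      = (4 * η ^ 2) • (Wᵀ * P.R * W) - (2 * η) • (Wᵀ * P.N K + (P.N K)ᵀ * W) := by
    rw [add_sub_cancel_left] at hdiff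
    rw [← hcl, ← neg_sub, Matrix.mul_neg, Matrix.neg_mul, ← neg_add, hdiff, neg_neg]
    simp only [transpose_smul, Matrix.smul_mul, Matrix.mul_smul, smul_smul]
    rw [show -(2 * η) * -(2 * η) = 4 * η ^ 2 by ring]
    simp only [smul_add, neg_smul]
    abel
  have key := trace_descent hη.le hlam hs0 hρ.le hY.posSemidef (Y_eq hK) hYτ
    (lambdaMin_posSemidef hS.transpose_eq) hR.posSemidef (lambdaMax_posSemidef hR.transpose_eq)
    hW hs1 hs2 (by rw [transpose_sub, hXK, hXL]) hDA (by linarith)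
  rw [Matrix.sub_mul, trace_sub, ← cost, ← cost] at key
  have hg : 0 ≤ (W * Wᵀ).trace := (posSemidef_mul_transpose W).trace_nonneg
  set g := (W * Wᵀ).trace
  set Δ := P.cost K - P.cost (K + -(2 * η) • W)
  have h1 : 4 * η ^ 2 * (τ * ρ) * g ≤ (1 - x) * Δ := by
    refine le_trans ?_ key
    -- With `a = ητρ`, the condition `2(a + x) ≤ 1` says `1 - a - 2x ≥ a`, which turns the descent
    -- factor into `a`.
    have : 0 ≤ 4 * η * g * (1 - 2 * (η * (τ * ρ) + x)) :=
      mul_nonneg (by positivity) (by linarith)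
    linear_combination this
  have h0 : 0 ≤ 4 * η ^ 2 * (τ * ρ) * g := by positivity
  have hΔ : 0 ≤ Δ := nonneg_of_mul_nonneg_right (h0.trans h1) (by linarith)
  have h2 : 0 ≤ x * Δ := mul_nonneg hx0 hΔ
  linarith

/-! ### Compactness and uniform bounds on sublevel sets -/

lemma trace_mul_transpose_eq_sum {k l : ℕ} (M : Matrix (Fin k) (Fin l) ℝ) :
    (M * Mᵀ).trace = ∑ i, ∑ j, M i j ^ 2 := by
  simp [trace, mul_apply, sq]

/-- Matrices all of whose entries have absolute value at most `r`. -/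
def box (k l : ℕ) (r : ℝ) : Set (Matrix (Fin k) (Fin l) ℝ) :=
  Set.univ.pi fun _ ↦ Set.univ.pi fun _ ↦ Set.Icc (-r) r

lemma isCompact_box (k l : ℕ) (r : ℝ) : IsCompact (box k l r) :=
  isCompact_univ_pi fun _ ↦ isCompact_univ_pi fun _ ↦ isCompact_Icc

lemma mem_box {k l : ℕ} {r : ℝ} (hr : 0 ≤ r) {M : Matrix (Fin k) (Fin l) ℝ}
    (h : (M * Mᵀ).trace ≤ r ^ 2) : M ∈ box k l r := by
  rw [trace_mul_transpose_eq_sum] at h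
  intro i _ j _
  refine abs_le.1 (abs_le_of_sq_le_sq ?_ hr)
  refine le_trans ?_ h
  refine (Finset.single_le_sum (f := fun j ↦ M i j ^ 2) (fun _ _ ↦ sq_nonneg _)
    (Finset.mem_univ j)).trans ?_
  exact Finset.single_le_sum (f := fun i ↦ ∑ j, M i j ^ 2)
    (fun _ _ ↦ Finset.sum_nonneg fun _ _ ↦ sq_nonneg _) (Finset.mem_univ i)

lemma mem_box_of_posSemidef {k : ℕ} {r : ℝ} {M : Matrix (Fin k) (Fin k) ℝ} (hM : M.PosSemidef)
    (h : M.trace ≤ r) : M ∈ box k k r := by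
  refine mem_box (hM.trace_nonneg.trans h) ?_
  rw [hM.transpose_eq]
  exact (trace_sq_le hM).trans (pow_le_pow_left₀ hM.trace_nonneg h 2)

/-- Inverts `Y⁻¹ ≤ θ` through the Cauchy–Schwarz bound `(x·x)² ≤ (x·Y⁻¹x)(x·Yx)`. -/
lemma posSemidef_sub_inv_trace_inv {ι : Type*} [Fintype ι] [DecidableEq ι] {Y : Matrix ι ι ℝ}
    (hY : Y.PosDef) {θ : ℝ} (hθ : 0 < θ) (h : Y⁻¹.trace ≤ θ) :
    (Y - θ⁻¹ • (1 : Matrix ι ι ℝ)).PosSemidef := by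
  have h1 := posSemidef_smul_one_sub_of_trace_le hY.inv.posSemidef h
  have hu : IsUnit Y.det := (isUnit_iff_isUnit_det _).1 hY.isUnit
  refine posSemidef_iff_real.2 ⟨by simp [hY.transpose_eq], fun x ↦ ?_⟩
  have hcs := trace_cauchySchwarz hY.posSemidef (replicateRow Unit (Y⁻¹ *ᵥ x))
    (replicateRow Unit x)
  have e : ∀ u v : ι → ℝ, (replicateRow Unit u * Y * (replicateRow Unit v)ᵀ).trace
      = u ⬝ᵥ Y *ᵥ v := fun u v ↦ by
    simp [trace, mul_apply, dotProduct, mulVec, Finset.sum_mul, Finset.mul_sum, mul_assoc]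
    exact Finset.sum_comm
  rw [e, e, e] at hcs
  have e1 : (Y⁻¹ *ᵥ x) ⬝ᵥ Y *ᵥ x = x ⬝ᵥ x := by
    rw [dotProduct_comm, dotProduct_mulVec, ← mulVec_transpose, hY.inv.transpose_eq, mulVec_mulVec,
      nonsing_inv_mul _ hu, one_mulVec]
  have e2 : (Y⁻¹ *ᵥ x) ⬝ᵥ Y *ᵥ (Y⁻¹ *ᵥ x) = x ⬝ᵥ Y⁻¹ *ᵥ x := by
    rw [mulVec_mulVec, Matrix.mul_nonsing_inv _ hu, one_mulVec, dotProduct_comm]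
  rw [e1, e2] at hcs
  have h5 := (posSemidef_iff_real.1 h1).2 x
  simp only [sub_mulVec, smul_mulVec, one_mulVec, dotProduct_sub, dotProduct_smul,
    smul_eq_mul] at h5 ⊢
  have hYx := (posSemidef_iff_real.1 hY.posSemidef).2 x
  have hx : 0 ≤ x ⬝ᵥ x := by
    simp only [dotProduct]; exact Finset.sum_nonneg fun i _ ↦ mul_self_nonneg _
  rcases hx.eq_or_lt with h0 | h0
  · rw [← h0]; linarith
  · rw [sub_nonneg, inv_mul_le_iff₀ hθ]
    refine le_of_mul_le_mul_left ?_ h0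
    nlinarith

/-- On a sublevel set of the cost, the gains are bounded and `Y` is bounded below. -/
lemma exists_sublevel_bounds (hn : 0 < n) (hm : 0 < m) (hQ : P.Q.PosDef) (hR : P.R.PosDef)
    (hS : P.Sig.PosDef) (F : ℝ) :
    ∃ y U : ℝ, 0 < y ∧ 0 ≤ U ∧ ∀ K ∈ P.stabilizing, P.cost K ≤ F →
      (P.Y K - y • (1 : Matrix (Fin n) (Fin n) ℝ)).PosSemidef ∧ (K * Kᵀ).trace ≤ U ^ 2 := by
  have hr := lambdaMin_pos hm hR
  have hlam := lambdaMin_pos hn hS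
  set r := lambdaMin P.R
  set lam := lambdaMin P.Sig
  set β := Real.sqrt (P.B * P.Bᵀ).trace with hβ
  have hβ0 : 0 ≤ β := Real.sqrt_nonneg _
  have hβ2 : β ^ 2 = (P.B * P.Bᵀ).trace :=
    Real.sq_sqrt (posSemidef_mul_transpose P.B).trace_nonneg
  set a := |P.A.trace|
  have ha : 0 ≤ a := abs_nonneg _
  set F' := max F 0
  have hF' : 0 ≤ F' := le_max_right _ _
  set c₁ := F' * (2 * a) / (r * lam) with hc₁
  set c₂ := F' * (2 * β) / (r * lam) with hc₂
  have h1 : 0 ≤ c₁ := by positivity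
  have h2 : 0 ≤ c₂ := by positivity
  set U := c₁ + c₂ + 1 with hU
  set Θ := (2 * a + 2 * β * U) / lam + 1 with hΘ
  have hΘ0 : 0 < Θ := by positivity
  refine ⟨Θ⁻¹, U, by positivity, by positivity, fun K hK hF ↦ ?_⟩
  have hY := Y_posDef hS hK
  have hu : IsUnit (P.Y K).det := (isUnit_iff_isUnit_det _).1 hY.isUnit
  set u := Real.sqrt (K * Kᵀ).trace with hu'
  have hu0 : 0 ≤ u := Real.sqrt_nonneg _
  have hu2 : u ^ 2 = (K * Kᵀ).trace := Real.sq_sqrt (posSemidef_mul_transpose K).trace_nonneg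
  have hBK : |(P.B * K).trace| ≤ β * u := by
    have := trace_cauchySchwarz_abs (PosSemidef.one (n := Fin m) (R := ℝ)) P.B Kᵀ hβ0 hu0
      (by simp [hβ2]) (by simp [hu2, trace_mul_comm Kᵀ])
    simpa using this
  -- Multiplying the Lyapunov equation by `Y⁻¹` and taking traces gives `tr(Y⁻¹ Σ) = -2 tr A_K`,
  -- which grows only linearly in the size `u` of `K`.
  have hθ : (P.Y K)⁻¹.trace ≤ (2 * a + 2 * β * u) / lam := by
    have e := le_trace_mul hY.inv.posSemidef (lambdaMin_posSemidef hS.transpose_eq)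
    have e2 : ((P.Y K)⁻¹ * P.Sig).trace = -2 * P.A.trace + 2 * (P.B * K).trace := by
      rw [eq_neg_of_add_eq_zero_right (Y_eq hK), Matrix.mul_neg, trace_neg, Matrix.mul_add,
        trace_add, trace_mul_comm, Matrix.mul_assoc, Matrix.mul_nonsing_inv _ hu,
        ← Matrix.mul_assoc, nonsing_inv_mul _ hu, Matrix.mul_one, Matrix.one_mul, trace_transpose,
        closedLoop, trace_sub]
      ring
    rw [e2] at e
    rw [le_div_iff₀' hlam]
    have := abs_le.1 hBK
    have := neg_abs_le P.A.trace
    linarith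
  have : Nonempty (Fin n) := ⟨⟨0, hn⟩⟩
  set θ := (P.Y K)⁻¹.trace with hθdef
  have hθ0 : 0 < θ := hY.inv.trace_pos
  have hYθ := posSemidef_sub_inv_trace_inv hY hθ0 le_rfl
  have hKYK : θ⁻¹ * (K * Kᵀ).trace ≤ (K * P.Y K * Kᵀ).trace := by
    have := (posSemidef_conj hYθ K).trace_nonneg
    simp only [Matrix.mul_sub, Matrix.sub_mul, Matrix.mul_smul, Matrix.smul_mul, Matrix.mul_one,
      trace_sub, trace_smul, smul_eq_mul] at this
    linarith
  have hcost : r * (K * P.Y K * Kᵀ).trace ≤ F' := by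
    have e1 := le_trace_mul (posSemidef_conj hY.posSemidef K) (lambdaMin_posSemidef hR.transpose_eq)
    have e2 : (K * P.Y K * Kᵀ * P.R).trace = (P.Y K * (Kᵀ * P.R * K)).trace := by
      rw [Matrix.mul_assoc, Matrix.mul_assoc, trace_mul_comm]
      simp only [Matrix.mul_assoc]
    have e3 := trace_mul_nonneg hY.posSemidef hQ.posSemidef
    have e4 := cost_eq hK
    rw [Matrix.mul_add, trace_add] at e4
    have := le_max_left F 0
    linarith
  -- The cost bounds `u ^ 2 / θ`, and `θ` is linear in `u`; a quadratic bounded by a linear function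
  -- keeps `u` below `U`.
  have hquad : u ^ 2 ≤ c₁ + c₂ * u := by
    have e1 : r * (θ⁻¹ * u ^ 2) ≤ F' := by
      rw [hu2]; exact (mul_le_mul_of_nonneg_left hKYK hr.le).trans hcost
    have e2 : r * u ^ 2 ≤ F' * θ := by
      refine le_trans (le_of_eq ?_) (mul_le_mul_of_nonneg_right e1 hθ0.le)
      field_simp
    have e3 := e2.trans (mul_le_mul_of_nonneg_left hθ hF')
    rw [hc₁, hc₂]
    rw [← le_div_iff₀' hr] at e3
    refine e3.trans_eq ?_
    field_simp
  have huU : u ≤ U := by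
    by_contra! hcon
    nlinarith
  refine ⟨posSemidef_sub_inv_trace_inv hY hΘ0 (hθ.trans ?_), ?_⟩
  · have : (2 * a + 2 * β * u) / lam ≤ (2 * a + 2 * β * U) / lam := by gcongr
    linarith
  · rw [← hu2]; exact pow_le_pow_left₀ hu0 huU 2

lemma continuous_spectralNorm {k : ℕ} :
    Continuous (spectralNorm : Matrix (Fin k) (Fin k) ℝ → ℝ) := by
  refine continuous_norm.comp ?_
  exact LinearMap.continuous_of_finiteDimensional
    ((Matrix.toEuclideanCLM (n := Fin k) (𝕜 := ℝ)).toAlgEquiv.toLinearMap)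

/-- Uniform bounds, including for the step size, on a sublevel set of the cost. -/
lemma exists_uniform_bounds (hn : 0 < n) (hm : 0 < m) (hQ : P.Q.PosDef) (hR : P.R.PosDef)
    (hS : P.Sig.PosDef) (F : ℝ) :
    ∃ y η r : ℝ, 0 < y ∧ 0 < η ∧ ∀ K ∈ P.stabilizing, P.cost K ≤ F →
      (P.Y K - y • (1 : Matrix (Fin n) (Fin n) ℝ)).PosSemidef ∧ η ≤ P.stepsize K ∧
      (K, P.X K, P.Y K) ∈ box m n r ×ˢ box n n r ×ˢ box n n r := by
  obtain ⟨y, U, hy, hU, h⟩ := exists_sublevel_bounds hn hm hQ hR hS F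
  have hq := lambdaMin_pos hn hQ
  have hlam := lambdaMin_pos hn hS
  have hr := lambdaMin_pos hm hR
  have hρ := lambdaMax_pos hm hR
  set r := max U (max (F / lambdaMin P.Sig) (F / lambdaMin P.Q)) with hrdef
  have hmem : ∀ K ∈ P.stabilizing, P.cost K ≤ F →
      (K, P.X K, P.Y K) ∈ box m n r ×ˢ box n n r ×ˢ box n n r := fun K hK hF ↦ by
    refine ⟨mem_box (hU.trans (le_max_left _ _)) ((h K hK hF).2.trans
      (pow_le_pow_left₀ hU (le_max_left _ _) 2)), mem_box_of_posSemidef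
      (X_posDef hQ hR hK).posSemidef (le_trans ?_ ((le_max_left _ _).trans (le_max_right _ _))),
      mem_box_of_posSemidef (Y_posDef hS hK).posSemidef
      (le_trans ?_ ((le_max_right _ _).trans (le_max_right _ _)))⟩
    · rw [le_div_iff₀' hlam]; exact (lambdaMin_mul_trace_X_le hQ hR hS hK).trans hF
    · rw [le_div_iff₀' hq]; exact (lambdaMin_mul_trace_Y_le hQ hR hS hK).trans hF
  have hcont : Continuous fun T : Matrix (Fin m) (Fin n) ℝ × Matrix (Fin n) (Fin n) ℝ ×
      Matrix (Fin n) (Fin n) ℝ ↦ spectralNorm (P.B * (P.R * T.1 - P.Bᵀ * T.2.1) * T.2.2) :=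
    continuous_spectralNorm.comp (by fun_prop)
  obtain ⟨s, hs⟩ := ((isCompact_box m n r).prod ((isCompact_box n n r).prod
    (isCompact_box n n r))).exists_bound_of_continuousOn hcont.continuousOn
  set F' := max F 0
  set s' := max s 0
  have hF' : 0 ≤ F' := le_max_right _ _
  have hs' : 0 ≤ s' := le_max_right _ _
  -- The final `+ 1` keeps `D` positive even if all the bounds vanish.
  set D := max (F' * lambdaMax P.R / lambdaMin P.Q + 4 * s' * F' / (lambdaMin P.Q * lambdaMin P.Sig))
    (4 * lambdaMin P.R * s' * F' / (lambdaMin P.Q * lambdaMin P.Sig)) + 1 with hD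
  have hD0 : 0 < D := by
    have : 0 ≤ 4 * lambdaMin P.R * s' * F' / (lambdaMin P.Q * lambdaMin P.Sig) := by positivity
    have := this.trans (le_max_right (F' * lambdaMax P.R / lambdaMin P.Q
      + 4 * s' * F' / (lambdaMin P.Q * lambdaMin P.Sig)) _)
    linarith
  refine ⟨y, Real.sqrt (1 / (3 * D) + 1 / 9) - 1 / 3, r, hy, (stepsize_spec hD0).1,
    fun K hK hF ↦ ⟨(h K hK hF).1, ?_, hmem K hK hF⟩⟩
  have hsK : spectralNorm (P.B * P.N K * P.Y K) ≤ s' :=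
    ((le_abs_self _).trans (hs _ (hmem K hK hF))).trans (le_max_left _ _)
  have hs0 := spectralNorm_nonneg (P.B * P.N K * P.Y K)
  have hcF : P.cost K ≤ F' := hF.trans (le_max_left _ _)
  have hc0 := cost_pos hn hQ hR hS hK
  have hd0 : 0 < P.dConst K :=
    (bConst_pos hn hm hQ hR hS hK).trans_le (le_max_left _ _)
  have hdD : P.dConst K ≤ D := by
    have : P.dConst K ≤ D - 1 := by
      rw [hD, add_sub_cancel_right]
      refine max_le_max ?_ ?_
      · rw [bConst]; gcongr
      · rw [cConst]; gcongr
    linarith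
  rw [stepsize]
  gcongr

/-! ### Growth, gradient domination and stationary limits -/

open Filter Topology

variable {Ks : Matrix (Fin m) (Fin n) ℝ}

/-- Quadratic growth of the cost around a stationary gain. -/
lemma quadratic_growth (hm : 0 < m) (hQ : P.Q.PosDef) (hR : P.R.PosDef) (hS : P.Sig.PosDef)
    (hKs : Ks ∈ P.stabilizing) (hN : P.N Ks = 0) (hL : L ∈ P.stabilizing) {y : ℝ}
    (hy : (P.Y L - y • (1 : Matrix (Fin n) (Fin n) ℝ)).PosSemidef) :
    lambdaMin P.R * y * ((L - Ks) * (L - Ks)ᵀ).trace ≤ P.cost L - P.cost Ks := by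
  have hr := lambdaMin_pos hm hR
  have hY := Y_posDef hS hL
  rw [cost_sub hQ hR hKs hL, hN]
  set E := L - Ks
  have e1 : (P.Y L * (Eᵀ * P.R * E)).trace = (E * P.Y L * Eᵀ * P.R).trace := by
    rw [Matrix.mul_assoc (E * P.Y L), Matrix.mul_assoc E, trace_mul_comm E]
    simp only [Matrix.mul_assoc]
  have e2 := le_trace_mul (posSemidef_conj hY.posSemidef E) (lambdaMin_posSemidef hR.transpose_eq)
  have e3 := (posSemidef_conj hy E).trace_nonneg
  simp only [Matrix.mul_sub, Matrix.sub_mul, Matrix.mul_smul, Matrix.smul_mul, Matrix.mul_one,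
    trace_sub, trace_smul, smul_eq_mul] at e3
  simp only [transpose_zero, Matrix.mul_zero, Matrix.zero_mul, add_zero, trace_zero, zero_add, e1]
  nlinarith

/-- Gradient domination. -/
lemma gradient_domination (hm : 0 < m) (hQ : P.Q.PosDef) (hR : P.R.PosDef) (hS : P.Sig.PosDef)
    (hKs : Ks ∈ P.stabilizing) (hK : K ∈ P.stabilizing) {y : ℝ} (hy0 : 0 < y)
    (hy : (P.Y K - y • (1 : Matrix (Fin n) (Fin n) ℝ)).PosSemidef) :
    P.cost K - P.cost Ks ≤ (P.Y Ks).trace / (lambdaMin P.R * y ^ 2)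
      * (P.N K * P.Y K * (P.N K * P.Y K)ᵀ).trace := by
  have hr := lambdaMin_pos hm hR
  have hY := Y_posDef hS hK
  have hYs := (Y_posDef hS hKs).posSemidef
  have hsub := cost_sub hQ hR hK hKs
  set E := Ks - K
  set N := P.N K
  set r := lambdaMin P.R
  -- Completing the square in `E`, with `R` replaced by its lower bound `r`.
  have hsq : (Eᵀ * N + Nᵀ * E + Eᵀ * P.R * E + r⁻¹ • (Nᵀ * N)).PosSemidef := by
    have h1 : (Eᵀ * (P.R - r • (1 : Matrix (Fin m) (Fin m) ℝ)) * E).PosSemidef := by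
      simpa using posSemidef_conj (lambdaMin_posSemidef hR.transpose_eq) Eᵀ
    have h2 := (posSemidef_transpose_mul (E + r⁻¹ • N)).smul hr.le
    convert h1.add h2 using 1
    simp only [transpose_add, transpose_smul, Matrix.add_mul, Matrix.mul_add, Matrix.mul_sub,
      Matrix.sub_mul, Matrix.mul_smul, Matrix.smul_mul, Matrix.mul_one, smul_add, smul_smul,
      mul_inv_cancel₀ hr.ne', one_smul]
    rw [← mul_assoc, mul_inv_cancel₀ hr.ne', one_mul]
    abel
  have h1 := trace_mul_nonneg hYs hsq
  have h2 : (P.Y Ks * (Nᵀ * N)).trace ≤ (P.Y Ks).trace * (N * Nᵀ).trace := by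
    rw [trace_mul_comm, trace_mul_comm N]
    exact trace_mul_le (posSemidef_transpose_mul N)
      (posSemidef_smul_one_sub_of_trace_le hYs le_rfl)
  have h3 : y ^ 2 * (N * Nᵀ).trace ≤ (N * P.Y K * (N * P.Y K)ᵀ).trace := by
    have a1 : (P.Y K * P.Y K - y ^ 2 • (1 : Matrix (Fin n) (Fin n) ℝ)).PosSemidef := by
      have b1 := posSemidef_mul_transpose (P.Y K - y • (1 : Matrix (Fin n) (Fin n) ℝ))
      rw [hy.transpose_eq] at b1
      convert b1.add (hy.smul (by positivity : 0 ≤ 2 * y)) using 1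
      simp only [Matrix.mul_sub, Matrix.sub_mul, Matrix.mul_smul, Matrix.smul_mul, Matrix.mul_one,
        Matrix.one_mul, smul_sub, smul_smul]
      module
    have a2 := (posSemidef_conj a1 N).trace_nonneg
    simp only [Matrix.mul_sub, Matrix.sub_mul, Matrix.mul_smul, Matrix.smul_mul, Matrix.mul_one,
      trace_sub, trace_smul, smul_eq_mul] at a2
    rw [transpose_mul, hY.transpose_eq, ← Matrix.mul_assoc, Matrix.mul_assoc N]
    linarith
  simp only [Matrix.mul_add, Matrix.mul_smul, trace_add, trace_smul, smul_eq_mul] at h1 hsub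
  have h4 : P.cost K - P.cost Ks ≤ r⁻¹ * (P.Y Ks * (Nᵀ * N)).trace := by linarith
  refine h4.trans ?_
  have hτ := hYs.trace_nonneg
  calc r⁻¹ * (P.Y Ks * (Nᵀ * N)).trace
      ≤ r⁻¹ * ((P.Y Ks).trace * (N * Nᵀ).trace) := by gcongr
    _ = (P.Y Ks).trace / (r * y ^ 2) * (y ^ 2 * (N * Nᵀ).trace) := by field_simp
    _ ≤ _ := by gcongr

instance {k l : ℕ} : FirstCountableTopology (Matrix (Fin k) (Fin l) ℝ) :=
  inferInstanceAs (FirstCountableTopology (Fin k → Fin l → ℝ))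

/-- A limit of gains in a compact range along which the gradient vanishes is stationary. -/
lemma exists_stationary {K : ℕ → Matrix (Fin m) (Fin n) ℝ}
    (hS : P.Sig.PosDef) (hK : ∀ j, K j ∈ P.stabilizing) {y r : ℝ} (hy : 0 < y)
    (hYy : ∀ j, (P.Y (K j) - y • (1 : Matrix (Fin n) (Fin n) ℝ)).PosSemidef)
    (hbox : ∀ j, (K j, P.X (K j), P.Y (K j)) ∈ box m n r ×ˢ box n n r ×ˢ box n n r)
    (hg : Tendsto (fun j ↦ (P.N (K j) * P.Y (K j) * (P.N (K j) * P.Y (K j))ᵀ).trace) atTop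
      (𝓝 0)) :
    ∃ Ks ∈ P.stabilizing, P.N Ks = 0 := by
  obtain ⟨⟨Ks, Xs, Ys⟩, -, φ, hφ, hlim⟩ := ((isCompact_box m n r).prod ((isCompact_box n n r).prod
    (isCompact_box n n r))).tendsto_subseq hbox
  have lim_eq : ∀ {Z : Type} [TopologicalSpace Z] [T2Space Z] {z : Z}
      {f : Matrix (Fin m) (Fin n) ℝ × Matrix (Fin n) (Fin n) ℝ × Matrix (Fin n) (Fin n) ℝ → Z},
      Continuous f → (∀ j, f (K j, P.X (K j), P.Y (K j)) = z) → f (Ks, Xs, Ys) = z :=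
    fun {Z} _ _ {z f} hf hz ↦ by
      have h1 := (hf.tendsto _).comp hlim
      refine tendsto_nhds_unique h1 ?_
      exact tendsto_const_nhds.congr fun j ↦ (hz (φ j)).symm
  have hYs_eq : P.closedLoop Ks * Ys + Ys * (P.closedLoop Ks)ᵀ + P.Sig = 0 :=
    lim_eq (f := fun T ↦ (P.A - P.B * T.1) * T.2.2 + T.2.2 * (P.A - P.B * T.1)ᵀ + P.Sig)
      (by fun_prop) fun j ↦ Y_eq (hK j)
  have hXs_eq : (P.closedLoop Ks)ᵀ * Xs + Xs * P.closedLoop Ks + (Ksᵀ * P.R * Ks + P.Q) = 0 :=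
    lim_eq (f := fun T ↦ (P.A - P.B * T.1)ᵀ * T.2.1 + T.2.1 * (P.A - P.B * T.1)
      + (T.1ᵀ * P.R * T.1 + P.Q)) (by fun_prop) fun j ↦ X_eq (hK j)
  have hYs_t : Ysᵀ - Ys = 0 :=
    lim_eq (f := fun T ↦ T.2.2ᵀ - T.2.2) (by fun_prop)
      fun j ↦ sub_eq_zero.2 (Y_posDef hS (hK j)).transpose_eq
  have hYs : (Ys - y • (1 : Matrix (Fin n) (Fin n) ℝ)).PosSemidef := by
    refine posSemidef_iff_real.2 ⟨by simp [sub_eq_zero.1 hYs_t], fun x ↦ ?_⟩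
    have hf : Continuous fun Z : Matrix (Fin n) (Fin n) ℝ ↦
        x ⬝ᵥ (Z - y • (1 : Matrix (Fin n) (Fin n) ℝ)) *ᵥ x := by
      fun_prop
    have ht : Tendsto (fun j ↦ P.Y (K (φ j))) atTop (𝓝 Ys) := hlim.snd_nhds.snd_nhds
    have ht' := (hf.tendsto Ys).comp ht
    refine ge_of_tendsto ht' (Eventually.of_forall fun j ↦ ?_)
    exact (posSemidef_iff_real.1 (hYy (φ j))).2 x
  have hYsd : Ys.PosDef := by
    have := ((PosDef.one (n := Fin n) (R := ℝ)).smul hy).add_posSemidef hYs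
    simpa using this
  -- The limit `Ys` stays bounded below and satisfies the limiting equation, so it certifies
  -- stability; continuity of `X` and `Y` in the gain is not needed.
  have hKs : Ks ∈ P.stabilizing := isHurwitz_of_posDef hYsd (by
    rw [← eq_neg_of_add_eq_zero_right hYs_eq]; exact hS)
  refine ⟨Ks, hKs, ?_⟩
  rw [N, X_unique hKs hXs_eq]
  have hcont : Continuous fun T : Matrix (Fin m) (Fin n) ℝ × Matrix (Fin n) (Fin n) ℝ ×
      Matrix (Fin n) (Fin n) ℝ ↦ ((P.R * T.1 - P.Bᵀ * T.2.1) * T.2.2 *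
        ((P.R * T.1 - P.Bᵀ * T.2.1) * T.2.2)ᵀ).trace := by fun_prop
  have h0 := tendsto_nhds_unique ((hcont.tendsto _).comp hlim) (hg.comp hφ.tendsto_atTop)
  have h1 : (P.R * Ks - P.Bᵀ * Xs) * Ys = 0 := by
    rw [← trace_mul_conjTranspose_self_eq_zero_iff, conjTranspose_eq_transpose_of_trivial]
    exact h0
  have hu : IsUnit Ys.det := (isUnit_iff_isUnit_det _).1 hYsd.isUnit
  calc _ = (P.R * Ks - P.Bᵀ * Xs) * Ys * Ys⁻¹ := by
        rw [Matrix.mul_assoc, Matrix.mul_nonsing_inv _ hu, Matrix.mul_one]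
    _ = 0 := by rw [h1, Matrix.zero_mul]

end Problem

lemma frobeniusNorm_eq {k l : ℕ} (M : Matrix (Fin k) (Fin l) ℝ) :
    frobeniusNorm M = Real.sqrt (M * Mᵀ).trace := by
  rw [frobeniusNorm, Problem.trace_mul_transpose_eq_sum]

end LQR

/-! ### Linear convergence -/

open LQR LQR.Problem in
theorem mainTheorem1 {n m : ℕ} (hn : 0 < n) (hm : 0 < m) (P : LQR.Problem n m)
    (hQ : P.Q.PosDef) (hR : P.R.PosDef)
    (hx₀ : Submodule.span ℝ (Set.range P.x₀) = ⊤)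
    (K : ℕ → Matrix (Fin m) (Fin n) ℝ)
    (hK₀ : K 0 ∈ P.stabilizing)
    (hK : ∀ j : ℕ, K (j + 1) = K j - P.stepsize (K j) • P.gradCost (K j)) :
    (∀ j : ℕ, K j ∈ P.stabilizing) ∧
    ∃ Kstar ∈ P.stabilizing,
      (∀ L ∈ P.stabilizing, L ≠ Kstar → P.cost Kstar < P.cost L) ∧
      ∃ q c₁ : ℝ, 0 < q ∧ q < 1 ∧ 0 < c₁ ∧
        ∀ j : ℕ,
          P.cost (K j) - P.cost Kstar ≤ q ^ j * (P.cost (K 0) - P.cost Kstar) ∧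
          LQR.frobeniusNorm (K j - Kstar) ≤ c₁ * q ^ ((j : ℝ) / 2) := by
  have hS := Sig_posDef hx₀
  have hstab : ∀ j, K j ∈ P.stabilizing := fun j ↦ by
    induction j with
    | zero => exact hK₀
    | succ j ih => rw [hK]; exact (gradient_step hn hm hQ hR hS ih).1
  refine ⟨hstab, ?_⟩
  have hq := lambdaMin_pos hn hQ
  have hr := lambdaMin_pos hm hR
  have hρ := lambdaMax_pos hm hR
  set g : ℕ → ℝ := fun j ↦ (P.N (K j) * P.Y (K j) * (P.N (K j) * P.Y (K j)).transpose).trace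
  have hg0 : ∀ j, 0 ≤ g j := fun j ↦ (posSemidef_mul_transpose _).trace_nonneg
  have hdec : ∀ j, 4 * P.stepsize (K j) ^ 2 * (P.cost (K j) / lambdaMin P.Q * lambdaMax P.R) * g j
      ≤ P.cost (K j) - P.cost (K (j + 1)) := fun j ↦ by
    rw [hK]; exact (gradient_step hn hm hQ hR hS (hstab j)).2
  have hcpos : ∀ j, 0 < P.cost (K j) := fun j ↦ cost_pos hn hQ hR hS (hstab j)
  have hanti : Antitone fun j ↦ P.cost (K j) := antitone_nat_of_succ_le fun j ↦ by
    have := hcpos j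
    have h1 := hg0 j
    have h2 : 0 ≤ 4 * P.stepsize (K j) ^ 2 * (P.cost (K j) / lambdaMin P.Q * lambdaMax P.R) * g j :=
      by positivity
    linarith [hdec j]
  have hF : ∀ j, P.cost (K j) ≤ P.cost (K 0) := fun j ↦ hanti (Nat.zero_le j)
  obtain ⟨y, η, r, hy, hη, hunif⟩ := exists_uniform_bounds hn hm hQ hR hS (P.cost (K 0))
  have hYy := fun j ↦ (hunif (K j) (hstab j) (hF j)).1
  have hyτ : ∀ j, y ≤ P.cost (K j) / lambdaMin P.Q := fun j ↦ by
    rw [le_div_iff₀' hq]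
    refine le_trans (mul_le_mul_of_nonneg_left ?_ hq.le)
      (lambdaMin_mul_trace_Y_le hQ hR hS (hstab j))
    have h1 := (hYy j).trace_nonneg
    have h2 : (1 : ℝ) ≤ n := by exact_mod_cast hn
    simp at h1
    nlinarith
  set h := 4 * η ^ 2 * (y * lambdaMax P.R) with hh
  have hh0 : 0 < h := by positivity
  have hdec' : ∀ j, h * g j ≤ P.cost (K j) - P.cost (K (j + 1)) := fun j ↦ by
    refine le_trans (mul_le_mul_of_nonneg_right ?_ (hg0 j)) (hdec j)
    have := (hunif (K j) (hstab j) (hF j)).2.1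
    have := hyτ j
    rw [hh]
    gcongr
  -- The costs decrease and are bounded below, so consecutive differences tend to zero.
  have hglim : Filter.Tendsto g Filter.atTop (nhds 0) := by
    have hbdd : BddBelow (Set.range fun j ↦ P.cost (K j)) :=
      ⟨0, by rintro _ ⟨j, rfl⟩; exact (hcpos j).le⟩
    have h1 := tendsto_atTop_ciInf hanti hbdd
    have h2 := (h1.sub (h1.comp (Filter.tendsto_add_atTop_nat 1))).div_const h
    rw [sub_self, zero_div] at h2
    refine squeeze_zero hg0 (fun j ↦ ?_) h2
    rw [le_div_iff₀' hh0]
    exact hdec' j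
  obtain ⟨Ks, hKs, hN⟩ := exists_stationary hS hstab hy hYy
    (fun j ↦ (hunif (K j) (hstab j) (hF j)).2.2) hglim
  have : Nonempty (Fin n) := ⟨⟨0, hn⟩⟩
  refine ⟨Ks, hKs, fun L hL hne ↦ ?_, ?_⟩
  · have hYL := Y_posDef hS hL
    have h1 := quadratic_growth hm hQ hR hS hKs hN hL (lambdaMin_posSemidef hYL.transpose_eq)
    have h2 : 0 < ((L - Ks) * (L - Ks).transpose).trace := by
      refine lt_of_le_of_ne (posSemidef_mul_transpose _).trace_nonneg fun h0 ↦ hne ?_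
      rw [← Matrix.conjTranspose_eq_transpose_of_trivial] at h0
      exact sub_eq_zero.1 (Matrix.trace_mul_conjTranspose_self_eq_zero_iff.1 h0.symm)
    have := mul_pos (mul_pos hr (lambdaMin_pos hn hYL)) h2
    linarith
  set G := (P.Y Ks).trace / (lambdaMin P.R * y ^ 2)
  have hG0 : 0 < G := div_pos (Y_posDef hS hKs).trace_pos (by positivity)
  have hdom : ∀ j, P.cost (K j) - P.cost Ks ≤ G * g j := fun j ↦
    gradient_domination hm hQ hR hS hKs (hstab j) hy (hYy j)
  -- This rate is weaker than `1 - h / G` but lies in `(0, 1)` without comparing `h` and `G`.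
  have hq0 : 0 < G / (G + h) := by positivity
  have hcost : ∀ j, P.cost (K j) - P.cost Ks ≤ (G / (G + h)) ^ j * (P.cost (K 0) - P.cost Ks) :=
      fun j ↦ by
    induction j with
    | zero => simp
    | succ j ih =>
      rw [pow_succ', mul_assoc]
      refine le_trans ?_ (mul_le_mul_of_nonneg_left ih hq0.le)
      rw [div_mul_eq_mul_div, le_div_iff₀ (by positivity)]
      have h1 := hdom j
      have h2 := hdec' j
      have h3 : h * (P.cost (K j) - P.cost Ks) ≤ (G + h) * (h * g j) := by
        have := mul_le_mul_of_nonneg_left h1 hh0.le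
        have : 0 ≤ h * (h * g j) := by have := hg0 j; positivity
        linarith
      have h4 := mul_le_mul_of_nonneg_left h2 (by positivity : 0 ≤ G + h)
      linarith
  have hgrow := fun j ↦ quadratic_growth hm hQ hR hS hKs hN (hstab j) (hYy j)
  set Δ := P.cost (K 0) - P.cost Ks
  -- The `+ 1` keeps the constant positive when the iteration starts at the minimizer.
  refine ⟨G / (G + h), Real.sqrt (Δ / (lambdaMin P.R * y)) + 1, hq0, ?_, by positivity,
    fun j ↦ ⟨hcost j, ?_⟩⟩
  · rw [div_lt_one (by positivity)]; linarith
  · generalize G / (G + h) = q at hq0 hcost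
    have h1 : ((K j - Ks) * (K j - Ks).transpose).trace ≤ Δ / (lambdaMin P.R * y) * q ^ j := by
      rw [div_mul_eq_mul_div, le_div_iff₀' (by positivity), mul_comm Δ]
      exact (hgrow j).trans (hcost j)
    have h2 : Real.sqrt (q ^ j) = q ^ ((j : ℝ) / 2) := by
      rw [Real.sqrt_eq_rpow, ← Real.rpow_natCast, ← Real.rpow_mul hq0.le]
      congr 1; ring
    rw [frobeniusNorm_eq, ← h2]
    refine (Real.sqrt_le_sqrt h1).trans ?_
    rw [Real.sqrt_mul' _ (by positivity)]
    have := Real.sqrt_nonneg (q ^ j)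
    linarith
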